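/- Let $n\ge 1$. All matrices are real $n\times n$; $X\ge 0$ means that $X$ is symmetric positive semidefinite, $\|\cdot\|$ is the Euclidean norm of vectors, $\|[Y_0,\dots,Y_k]\|_F$ is the Frobenius norm of the block row, and $\lambda_{\min}$ is the smallest eigenvalue of a symmetric matrix. Let $\mathcal P$ be the class of matrix polynomials $\lambda^2M-\lambda(G-D)+K$ with $M,D,K\ge 0$ and $G^\top=-G$, regarded as polynomials of grade two (i.e. the leading coefficient may vanish) and identified with their triples of coefficients; $\|\lambda^2P_2+\lambda P_1+P_0\|_F:=\|[P_0,P_1,P_2]\|_F$, and closures are taken with respect to this norm. A polynomial $P(\lambda)=\lambda^2P_2+\lambda P_1+P_0$ is *singular* if $\det P(\lambda)\equiv 0$, and *regular* otherwise. Its *index* is the size of the largest block $\lambda\mathcal J_\sigma(0)-I_\sigma$ ($0$ if there is none) in the Kronecker canonical form over $\mathbb C$ of the companion pencil $$\lambda\begin{bmatrix}P_2&0\\0&I\end{bmatrix}+\begin{bmatrix}P_1&P_0\\-I&0\end{bmatrix}.$$ $P$ is *stable* if this pencil is regular, all its finite eigenvalues have real part $\le 0$, and all its Jordan blocks for eigenvalues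 on the imaginary axis, including $\infty$, have size one; otherwise $P$ is *unstable*. For $P\in\mathcal P$ let $d_{\rm sing}(P)$, $d_{\rm hi}(P)$, $d_{\rm inst}(P)$ be the infimum of $\|\Delta(\lambda)\|_F$ over all $\Delta(\lambda)$ such that $P+\Delta\in\mathcal P$ is singular, respectively of index $\ge 2$, respectively unstable. For $J^\top=-J$ and $X_0,\dots,X_\ell\ge 0$ let $d_{\rm ck}(J,X_0,\dots,X_\ell)$ be the infimum of $\|[\Delta_J,\Delta_{X_0},\dots,\Delta_{X_\ell}]\|_F$ over all perturbations with $(J+\Delta_J)^\top=-(J+\Delta_J)$, $X_i+\Delta_{X_i}\ge 0$ for all $i$, and $\ker(J+\Delta_J)\cap\bigcap_{i=0}^\ell\ker(X_i+\Delta_{X_i})\ne\{0\}$. For a unit vector $u$ and a matrix $Y$ put $\Delta_Y^u=-uu^\top Y-Yuu^\top+uu^\top Yuu^\top$. Matrices are said to have a common kernel if their kernels have an intersection different from $\{0\}$. **Theorem.** Let $P(\lambda)=\lambda^2M-\lambda(G-D)+K\in\mathcal P$, with $M,D,K\ge0$ and $G^\top=-G$. (i) $P$ is singular if and only if $M,D,K,G$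 have a common kernel. There is a unit vector $u$ such that, with $\Delta(\lambda)=\lambda^2\Delta_M^u-\lambda(\Delta_G^u-\Delta_D^u)+\Delta_K^u$, the polynomial $P+\Delta$ belongs to $\mathcal P$ and is singular, and $\|\Delta\|_F=d_{\rm sing}(P)$. Moreover $d_{\rm sing}(P)=d_{\rm ck}(G,M,D,K)$, where $$d_{\rm ck}(G,M,D,K)=\min_{\|u\|=1}\Big(2\|Gu\|^2+\sum_{X\in\{M,D,K\}}\big(2\|(I-uu^\top)Xu\|^2+(u^\top Xu)^2\big)\Big)^{1/2}$$ (one summand for each of the three matrices), and $$\sqrt{\lambda_{\min}(M^2+D^2+K^2-G^2)}\le d_{\rm sing}(P)\le\sqrt{2\lambda_{\min}(M^2+D^2+K^2-G^2)}.$$ (ii) $P$ lies in the closure of the set of polynomials in $\mathcal P$ that are regular and of index larger than one if and only if $M$ and $D$ have a common kernel; all polynomials in that set have index exactly two. There is a unit vector $u$ such that, with $\Delta(\lambda)=\lambda^2\Delta_M^u+\lambda\Delta_D^u$, the polynomial $P+\Delta$ lies in that closure and $\|\Delta\|_F=d_{\rm hi}(P)$. Moreover $d_{\rm hi}(P)=d_{\rm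 ck}(0,M,D)$, where $$d_{\rm ck}(0,M,D)=\min_{\|u\|=1}\Big(\sum_{X\in\{M,D\}}\big(2\|(I-uu^\top)Xu\|^2+(u^\top Xu)^2\big)\Big)^{1/2},$$ and $\sqrt{\lambda_{\min}(M^2+D^2)}\le d_{\rm hi}(P)\le\sqrt{2\lambda_{\min}(M^2+D^2)}$. (iii) $P$ lies in the closure of the set of unstable polynomials in $\mathcal P$ if and only if $M$ and $D$ have a common kernel or $D$ and $K$ have a common kernel. There are a unit vector $u$ and $\Delta(\lambda)$, equal to $\lambda^2\Delta_M^u+\lambda\Delta_D^u$ or to $\lambda\Delta_D^u+\Delta_K^u$, such that $P+\Delta$ lies in that closure and $\|\Delta\|_F=d_{\rm inst}(P)$. Moreover $$d_{\rm inst}(P)=\min\{d_{\rm ck}(0,M,D),\,d_{\rm ck}(0,D,K)\},$$ where $d_{\rm ck}(0,D,K)$ is given by the same minimum as $d_{\rm ck}(0,M,D)$, with $D,K$ in place of $M,D$, and, with $\alpha=\min\{\lambda_{\min}(M^2+D^2),\lambda_{\min}(D^2+K^2)\}$, $$\sqrt{\alpha}\le d_{\rm inst}(P)\le\sqrt{2\alpha}.$$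 -/

import Mathlib

open scoped Matrix Polynomial

noncomputable section

namespace DHQuad

/-! ### Norms, kernels, smallest eigenvalue -/

/-- The Frobenius norm `‖[Y 0, …]‖_F` of the block row formed by a finite family of real matrices.
Applied to the family of coefficients it is the Frobenius norm of a matrix polynomial. -/
def frobNorm {ι : Type*} [Fintype ι] {n : ℕ} (Y : ι → Matrix (Fin n) (Fin n) ℝ) : ℝ :=
  √(∑ i, ∑ a, ∑ b, (Y i a b) ^ 2)

/-- The intersection of the kernels of the matrices of the family is different from `{0}`. -/
def HaveCommonKernel {ι : Type*} {n : ℕ} (Y : ι → Matrix (Fin n) (Fin n) ℝ) : Prop :=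
  ∃ v : Fin n → ℝ, v ≠ 0 ∧ ∀ i, Y i *ᵥ v = 0

/-- The smallest (real) eigenvalue. It is only used for symmetric matrices of size `n ≥ 1`, whose
real spectrum is finite and nonempty. -/
def lambdaMin {n : ℕ} (X : Matrix (Fin n) (Fin n) ℝ) : ℝ :=
  sInf (spectrum ℝ X)

/-- The squared Euclidean norm `‖v‖₂²`. -/
def sqNorm {n : ℕ} (v : Fin n → ℝ) : ℝ := v ⬝ᵥ v

/-- The unit vectors of `ℝⁿ` with respect to the Euclidean norm. -/
def unitVectors (n : ℕ) : Set (Fin n → ℝ) := {u | sqNorm u = 1}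

/-- The perturbation `Δ_Y^u = -u uᵀ Y - Y u uᵀ + u uᵀ Y u uᵀ`. -/
def pert {n : ℕ} (u : Fin n → ℝ) (Y : Matrix (Fin n) (Fin n) ℝ) : Matrix (Fin n) (Fin n) ℝ :=
  -(Matrix.vecMulVec u u * Y) - Y * Matrix.vecMulVec u u
    + Matrix.vecMulVec u u * Y * Matrix.vecMulVec u u

/-! ### Structured distance to the common kernel -/

/-- The tuples `(J, X_0, …, X_ℓ)` of real `n × n` matrices with `J` skew-symmetric and all `X_i`
symmetric positive semidefinite (`J` is the entry of index `0`, `X_i` that of index `i + 1`). -/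
def structTuples (n ℓ : ℕ) : Set (Fin (ℓ + 2) → Matrix (Fin n) (Fin n) ℝ) :=
  {Y | (Y 0)ᵀ = -Y 0 ∧ ∀ i : Fin (ℓ + 1), (Y i.succ).PosSemidef}

/-- The structured distance to the common kernel `d_ck(J, X_0, …, X_ℓ)`. For `n ≥ 1` the infimum
is over a nonempty set, since `-Y` is an admissible perturbation. -/
def distCommonKernel {n ℓ : ℕ} (Y : Fin (ℓ + 2) → Matrix (Fin n) (Fin n) ℝ) : ℝ :=
  sInf (frobNorm '' {Δ | Y + Δ ∈ structTuples n ℓ ∧ HaveCommonKernel (Y + Δ)})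

/-- The function
`u ↦ (2‖Ju‖² + ∑ i, (2‖(I - u uᵀ) X_i u‖² + (uᵀ X_i u)²))^(1/2)`
for the tuple `(J, X_0, …, X_ℓ)`. -/
def kernelCost {n ℓ : ℕ} (Y : Fin (ℓ + 2) → Matrix (Fin n) (Fin n) ℝ) (u : Fin n → ℝ) : ℝ :=
  √(2 * sqNorm (Y 0 *ᵥ u) + ∑ i : Fin (ℓ + 1),
    (2 * sqNorm ((1 - Matrix.vecMulVec u u) *ᵥ (Y i.succ *ᵥ u)) + (u ⬝ᵥ (Y i.succ *ᵥ u)) ^ 2))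

/-! ### Kronecker canonical form of a pencil `λE - A` -/

/-- The types of blocks of a Kronecker canonical form. -/
inductive KroneckerBlock : Type
  /-- `𝓛_ε`, of size `ε × (ε + 1)` -/
  | right (ε : ℕ)
  /-- `𝓛_ηᵀ`, of size `(η + 1) × η` -/
  | left (η : ℕ)
  /-- `λI - 𝓙_ρ(lam)`, for the finite eigenvalue `lam` -/
  | finite (lam : ℂ) (ρ : ℕ+)
  /-- `λ𝓙_σ(0) - I`, for the eigenvalue `∞` -/
  | infinite (σ : ℕ+)

namespace KroneckerBlock

/-- Number of rows. -/
def rows : KroneckerBlock → ℕ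
  | right ε => ε
  | left η => η + 1
  | finite _ ρ => ρ
  | infinite σ => σ

/-- Number of columns. -/
def cols : KroneckerBlock → ℕ
  | right ε => ε + 1
  | left η => η
  | finite _ ρ => ρ
  | infinite σ => σ

/-- The matrix `E` of the block `λE - A`. -/
def lead : (b : KroneckerBlock) → Matrix (Fin b.rows) (Fin b.cols) ℂ
  | right _ => fun i j => if j.val = i.val then 1 else 0
  | left _ => fun i j => if i.val = j.val then 1 else 0
  | finite _ _ => fun i j => if i.val = j.val then 1 else 0
  | infinite _ => fun i j => if j.val = i.val + 1 then 1 else 0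

/-- The matrix `A` of the block `λE - A`. -/
def const : (b : KroneckerBlock) → Matrix (Fin b.rows) (Fin b.cols) ℂ
  | right _ => fun i j => if j.val = i.val + 1 then 1 else 0
  | left _ => fun i j => if i.val = j.val + 1 then 1 else 0
  | finite lam _ => fun i j => if i.val = j.val then lam else if j.val = i.val + 1 then 1 else 0
  | infinite _ => fun i j => if i.val = j.val then 1 else 0

/-- The size of a block at `∞`; `0` for the other blocks. -/
def infiniteSize : KroneckerBlock → ℕ
  | infinite σ => σ
  | _ => 0

/-- Eigenvalues lie in the closed left half plane, and blocks for eigenvalues on the imaginary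
axis, including `∞`, have size one. Blocks without eigenvalue are not restricted. -/
def IsStable : KroneckerBlock → Prop
  | right _ => True
  | left _ => True
  | finite lam ρ => lam.re ≤ 0 ∧ (lam.re = 0 → ρ = 1)
  | infinite σ => σ = 1

end KroneckerBlock

/-- `S (λE - A) T = diag(b 0, …, b (s-1))` for some nonsingular complex `S` and `T`, that is, the
list `b` of blocks is the Kronecker canonical form of `λE - A`. The bijections `er`, `ec` only
number the rows and columns of the block diagonal matrix. -/
def IsKroneckerForm {m m' : Type*} [Fintype m] [DecidableEq m] [Fintype m'] [DecidableEq m']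
    (E A : Matrix m m' ℂ) {s : ℕ} (b : Fin s → KroneckerBlock) : Prop :=
  ∃ (er : m ≃ (i : Fin s) × Fin (b i).rows) (ec : m' ≃ (i : Fin s) × Fin (b i).cols)
    (S : Matrix m m ℂ) (T : Matrix m' m' ℂ), IsUnit S ∧ IsUnit T ∧
      S * E * T = (Matrix.blockDiagonal' fun i => (b i).lead).submatrix er ec ∧
      S * A * T = (Matrix.blockDiagonal' fun i => (b i).const).submatrix er ec

/-- The index of `λE - A` is `ν`: it is the size of the largest block at `∞` in the Kronecker
canonical form, and `0` if there is no such block. -/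
def PencilHasIndex {m : Type*} [Fintype m] [DecidableEq m] (E A : Matrix m m ℂ) (ν : ℕ) : Prop :=
  ∃ (s : ℕ) (b : Fin s → KroneckerBlock), IsKroneckerForm E A b ∧
    ν = Finset.univ.sup fun i => (b i).infiniteSize

/-- The square pencil `λE - A` is regular. -/
def PencilIsRegular {m : Type*} [Fintype m] [DecidableEq m] (E A : Matrix m m ℂ) : Prop :=
  ∃ z : ℂ, (z • E - A).det ≠ 0

/-- The pencil `λE - A` is stable: it is regular, all eigenvalues are in the closed left half
plane, and those on the imaginary axis (including `∞`) have largest block of size one. -/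
def PencilIsStable {m : Type*} [Fintype m] [DecidableEq m] (E A : Matrix m m ℂ) : Prop :=
  PencilIsRegular E A ∧ ∃ (s : ℕ) (b : Fin s → KroneckerBlock), IsKroneckerForm E A b ∧
    ∀ i, (b i).IsStable

/-! ### Quadratic matrix polynomials

A quadratic matrix polynomial `λ²P₂ + λP₁ + P₀` (of grade two: `P₂ = 0` is allowed) is the family
of its coefficients. -/

/-- The polynomial `λ²M - λ(G - D) + K`. -/
def quadPoly {n : ℕ} (M D K G : Matrix (Fin n) (Fin n) ℝ) : Fin 3 → Matrix (Fin n) (Fin n) ℝ :=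
  ![K, -(G - D), M]

/-- The class of all `λ²M - λ(G - D) + K` with `G` skew-symmetric and `M, D, K` symmetric positive
semidefinite. -/
def dHClass (n : ℕ) : Set (Fin 3 → Matrix (Fin n) (Fin n) ℝ) :=
  {P | ∃ M D K G : Matrix (Fin n) (Fin n) ℝ,
    M.PosSemidef ∧ D.PosSemidef ∧ K.PosSemidef ∧ Gᵀ = -G ∧ P = quadPoly M D K G}

/-- `det P(λ)` is identically zero. -/
def IsSingular {n : ℕ} (P : Fin 3 → Matrix (Fin n) (Fin n) ℝ) : Prop :=
  (∑ i : Fin 3, (Polynomial.X : ℝ[X]) ^ (i : ℕ) • (P i).map Polynomial.C).det = 0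

/-- The leading coefficient `E` of the companion linearization
`λE - A = λ[P₂, 0; 0, I] + [P₁, P₀; -I, 0]`. -/
def companionLead {n : ℕ} (P : Fin 3 → Matrix (Fin n) (Fin n) ℝ) :
    Matrix (Fin n ⊕ Fin n) (Fin n ⊕ Fin n) ℂ :=
  (Matrix.fromBlocks (P 2) 0 0 1).map Complex.ofReal

/-- The matrix `A` of the companion linearization
`λE - A = λ[P₂, 0; 0, I] + [P₁, P₀; -I, 0]`. -/
def companionConst {n : ℕ} (P : Fin 3 → Matrix (Fin n) (Fin n) ℝ) :
    Matrix (Fin n ⊕ Fin n) (Fin n ⊕ Fin n) ℂ :=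
  (-Matrix.fromBlocks (P 1) (P 0) (-1) 0).map Complex.ofReal

/-- The index of a quadratic matrix polynomial is that of its companion linearization. -/
def HasIndex {n : ℕ} (P : Fin 3 → Matrix (Fin n) (Fin n) ℝ) (ν : ℕ) : Prop :=
  PencilHasIndex (companionLead P) (companionConst P) ν

/-- A quadratic matrix polynomial is unstable if its companion linearization is not stable. In
particular singular polynomials are unstable. -/
def IsUnstable {n : ℕ} (P : Fin 3 → Matrix (Fin n) (Fin n) ℝ) : Prop :=
  ¬ PencilIsStable (companionLead P) (companionConst P)

/-- The polynomials of the class that are regular and of index larger than one. -/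
def regularHighIndex (n : ℕ) : Set (Fin 3 → Matrix (Fin n) (Fin n) ℝ) :=
  {P | P ∈ dHClass n ∧ ¬ IsSingular P ∧ ∃ ν, HasIndex P ν ∧ 1 < ν}

/-- The unstable polynomials of the class. -/
def unstableSet (n : ℕ) : Set (Fin 3 → Matrix (Fin n) (Fin n) ℝ) :=
  {P | P ∈ dHClass n ∧ IsUnstable P}

/-- The structured distance to singularity. -/
def distSing {n : ℕ} (P : Fin 3 → Matrix (Fin n) (Fin n) ℝ) : ℝ :=
  sInf (frobNorm '' {Δ | P + Δ ∈ dHClass n ∧ IsSingular (P + Δ)})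

/-- The structured distance to the nearest high-index problem. -/
def distHighIndex {n : ℕ} (P : Fin 3 → Matrix (Fin n) (Fin n) ℝ) : ℝ :=
  sInf (frobNorm '' {Δ | P + Δ ∈ dHClass n ∧ ∃ ν, HasIndex (P + Δ) ν ∧ 2 ≤ ν})

/-- The structured distance to instability. -/
def distInstability {n : ℕ} (P : Fin 3 → Matrix (Fin n) (Fin n) ℝ) : ℝ :=
  sInf (frobNorm '' {Δ | P + Δ ∈ dHClass n ∧ IsUnstable (P + Δ)})

end DHQuad

end

noncomputable section

namespace DHQuad

open Module

/-! ### Existence of the Kronecker canonical form of a regular pencil -/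

/-! Everything rests on testing vector identities with quadratic forms. For complex `q` the numbers
`q* X q` are nonnegative for semidefinite `X` and vanish only if `X q = 0`, while `q* G q` is purely
imaginary. If `P(1) p = 0`, the real part of `p* P(1) p` is a sum of three nonnegative terms, so `p`
lies in all four kernels; conversely a common kernel vector makes `det P(λ)` vanish. The same
argument applied to Jordan chains of the companion pencil shows that index at least two forces a
common kernel of `M` and `D`, that a chain of length three at infinity forces singularity, and that
instability forces a common kernel of `M, D` or of `D, K` (`exists_of_infinite_chain`,
`index_le_two`, `re_nonpos_of_eigenvector`, `haveCommonKernel_of_imaginary_chain`).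

Conversely, if `M v = D v = 0` for a unit vector `v`, a chain of length two at infinity exists as
soon as `G v` lies in the range of `M`. Since `G v` is orthogonal to `v`, adding `ε (1 - v vᵀ)` to
`M` achieves this, and adding `ε` to `K` makes the polynomial regular; at the eigenvalue zero `K`
takes the role of `M`. Having a common kernel is a closed condition, because the unit sphere is
compact, so it describes the closures exactly.

Chains and Kronecker forms are linked in both directions: a chain of the pencil has a nonzero
component in some block, and a chain of a block embeds into the pencil. Hence uniqueness of the form
is not needed. Its existence for regular pencils is needed, and follows from the structure theorem
for torsion modules over `ℂ[X]`.

For the distances, fix a unit vector `u`. The map `X ↦ X + pert u X` is the compression to the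
orthogonal complement of `u`. It preserves the structure and is an orthogonal projection for the
Frobenius inner product, so `pert u X` is the cheapest structured way to put `u` into the kernel
(`frobSq_pert_le_of_mulVec`). Minimizing over the compact sphere gives `distCommonKernel`,
comparison with `∑ ‖X u‖²` gives the eigenvalue bounds, and continuity of the norm carries
minimizers in the closure over to the infima (`sInf_frobNorm_eq`). -/

/-- A nilpotent endomorphism of maximal nilpotency order has a basis on which it acts as a single
Jordan block. -/
theorem exists_basis_of_nilpotent {F U : Type*} [Field F] [AddCommGroup U] [Module F U]
    [FiniteDimensional F U] (l : End F U) {e : ℕ} (he : finrank F U = e) (h0 : l ^ e = 0)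
    (h1 : l ^ (e - 1) ≠ 0) :
    ∃ v : Basis (Fin e) F U, ∀ c, l (v c) =
      ∑ a : Fin e, (if c.val = a.val + 1 then (1 : F) else 0) • v a := by
  obtain ⟨y, hy⟩ : ∃ y, (l ^ (e - 1)) y ≠ 0 := by
    by_contra! h
    exact h1 (LinearMap.ext h)
  have hz : ∀ k, e ≤ k → (l ^ k) y = 0 := fun k hk => by
    rw [← Nat.sub_add_cancel hk, pow_add, h0, mul_zero, LinearMap.zero_apply]
  have li : LinearIndependent F fun k : Fin e => (l ^ (e - 1 - k.val)) y := by
    rw [Fintype.linearIndependent_iff]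
    intro g hg
    -- Induction from the last index down. Applying `l ^ i` kills the terms `j < i`, whose exponent
    -- reaches `e`; the terms `j > i` already have coefficient zero, so only `g i • (l ^ (e - 1)) y`
    -- survives.
    have key : ∀ m : ℕ, ∀ i : Fin e, e - 1 - i.val = m → g i = 0 := by
      intro m
      induction m using Nat.strong_induction_on with
      | _ m ih =>
        intro i hi
        have h := congrArg (l ^ i.val) hg
        rw [map_sum, map_zero, Finset.sum_eq_single i] at h
        · rw [map_smul, ← Module.End.mul_apply, ← pow_add,
            show i.val + (e - 1 - i.val) = e - 1 by omega] at h
          exact (smul_eq_zero.mp h).resolve_right hy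
        · intro j _ hji
          rcases lt_or_gt_of_ne hji with hlt | hlt
          · rw [map_smul, ← Module.End.mul_apply, ← pow_add, hz _ (by
              have : j.val < i.val := hlt
              omega), smul_zero]
          · have : i.val < j.val := hlt
            rw [ih _ (by omega) j rfl, zero_smul, map_zero]
        · simp
    exact fun i => key _ i rfl
  -- For `e = 0` the truncated exponent `e - 1` is `0`, so `hy` would give a nonzero vector in the
  -- zero space.
  have : Nonempty (Fin e) := by
    by_contra hne
    have : e = 0 := by
      rcases Nat.eq_zero_or_pos e with h | h
      · exact h
      · exact (hne ⟨⟨0, h⟩⟩).elim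
    subst this
    have := finrank_zero_iff.mp he
    exact hy (Subsingleton.elim _ _)
  refine ⟨basisOfLinearIndependentOfCardEqFinrank li (by simp [he]), fun c => ?_⟩
  simp only [coe_basisOfLinearIndependentOfCardEqFinrank, ite_smul, one_smul, zero_smul]
  rw [← Module.End.mul_apply, ← pow_succ']
  have hc := c.isLt
  rcases Nat.eq_zero_or_pos c.val with h | h
  · rw [hz _ (by omega), Finset.sum_eq_zero]
    intro a _
    rw [if_neg (by omega)]
  · rw [Finset.sum_eq_single (⟨c.val - 1, by omega⟩ : Fin e)]
    · rw [if_pos (by simp; omega)]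
      congr 2
      simp only
      omega
    · intro b _ hb
      rw [if_neg]
      intro h'
      exact hb (Fin.ext (by simp; omega))
    · simp

/-- The pair of linear maps `f, g` is represented by the block diagonal pencil with blocks `B`. -/
def HasBlockBases {κ V W : Type*} [AddCommGroup V] [Module ℂ V] [AddCommGroup W] [Module ℂ W]
    (f g : V →ₗ[ℂ] W) (B : κ → KroneckerBlock) : Prop :=
  ∃ (v : Basis (Σ k, Fin (B k).cols) ℂ V) (w : Basis (Σ k, Fin (B k).rows) ℂ W), ∀ k c,
    f (v ⟨k, c⟩) = ∑ a, (B k).lead a c • w ⟨k, a⟩ ∧ g (v ⟨k, c⟩) = ∑ a, (B k).const a c • w ⟨k, a⟩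

theorem HasBlockBases.of_unique {κ V W : Type*} [Unique κ] [AddCommGroup V] [Module ℂ V]
    [AddCommGroup W] [Module ℂ W] {f g : V →ₗ[ℂ] W} (B : KroneckerBlock)
    (v : Basis (Fin B.cols) ℂ V) (w : Basis (Fin B.rows) ℂ W)
    (h : ∀ c, f (v c) = ∑ a, B.lead a c • w a ∧ g (v c) = ∑ a, B.const a c • w a) :
    HasBlockBases f g fun _ : κ => B :=
  ⟨v.reindex (Equiv.uniqueSigma fun _ : κ => Fin B.cols).symm,
    w.reindex (Equiv.uniqueSigma fun _ : κ => Fin B.rows).symm, fun k c => by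
      simpa [Equiv.uniqueSigma] using h c⟩

theorem HasBlockBases.infinite {κ V W : Type*} [Unique κ] [AddCommGroup V] [Module ℂ V]
    [AddCommGroup W] [Module ℂ W] {f g : V →ₗ[ℂ] W} (σ : ℕ+)
    (v : Basis (Fin σ) ℂ V) (w : Basis (Fin σ) ℂ W)
    (hf : ∀ c, f (v c) = ∑ a : Fin σ, (if c.val = a.val + 1 then (1 : ℂ) else 0) • w a)
    (hg : ∀ c, g (v c) = w c) :
    HasBlockBases f g fun _ : κ => KroneckerBlock.infinite σ := by
  refine .of_unique (.infinite σ) v w fun (c : Fin σ) => ⟨hf c, ?_⟩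
  refine (hg c).trans (Eq.symm ?_)
  change ∑ a : Fin σ, (if a.val = c.val then (1 : ℂ) else 0) • w a = w c
  simp [Fin.val_inj]

theorem HasBlockBases.finite {κ V W : Type*} [Unique κ] [AddCommGroup V] [Module ℂ V]
    [AddCommGroup W] [Module ℂ W] {f g : V →ₗ[ℂ] W} (lam : ℂ) (ρ : ℕ+)
    (v : Basis (Fin ρ) ℂ V) (w : Basis (Fin ρ) ℂ W)
    (hf : ∀ c, f (v c) = w c)
    (hg : ∀ c, g (v c) = lam • w c +
      ∑ a : Fin ρ, (if c.val = a.val + 1 then (1 : ℂ) else 0) • w a) :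
    HasBlockBases f g fun _ : κ => KroneckerBlock.finite lam ρ := by
  refine .of_unique (.finite lam ρ) v w fun (c : Fin ρ) =>
    ⟨(hf c).trans (Eq.symm ?_), (hg c).trans (Eq.symm ?_)⟩
  · change ∑ a : Fin ρ, (if a.val = c.val then (1 : ℂ) else 0) • w a = w c
    simp [Fin.val_inj]
  · change ∑ a : Fin ρ, (if a.val = c.val then lam else
      if c.val = a.val + 1 then (1 : ℂ) else 0) • w a = _
    have h : ∀ a : Fin ρ, (if a.val = c.val then lam else
        if c.val = a.val + 1 then (1 : ℂ) else 0) = (if a = c then lam else 0) +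
          (if c.val = a.val + 1 then (1 : ℂ) else 0) := fun a => by
      rcases eq_or_ne a c with h | h
      · subst h; simp
      · simp [h, Fin.val_inj]
    simp only [h, add_smul, Finset.sum_add_distrib]
    simp

theorem HasBlockBases.reindex {κ κ' V W : Type*} [AddCommGroup V] [Module ℂ V] [AddCommGroup W]
    [Module ℂ W] {f g : V →ₗ[ℂ] W} {B : κ → KroneckerBlock} (h : HasBlockBases f g B)
    (σ : κ' ≃ κ) : HasBlockBases f g (B ∘ σ) := by
  obtain ⟨v, w, hvw⟩ := h
  refine ⟨v.reindex (Equiv.sigmaCongrLeft (β := fun k => Fin (B k).cols) σ).symm,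
    w.reindex (Equiv.sigmaCongrLeft (β := fun k => Fin (B k).rows) σ).symm, fun k c => ?_⟩
  simpa using hvw (σ k) c

theorem dfinsupp_basis_apply {F ι : Type*} [Field F] [DecidableEq ι] {M : ι → Type*}
    [∀ i, AddCommGroup (M i)] [∀ i, Module F (M i)] {η : ι → Type*} (b : ∀ i, Basis (η i) F (M i))
    (i : ι) (a : η i) : DFinsupp.basis b ⟨i, a⟩ = DFinsupp.single i (b i a) := by
  classical
  rw [Basis.apply_eq_iff]
  simp [DFinsupp.basis, Equiv.symm_apply_eq, sigmaFinsuppEquivDFinsupp_single]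

theorem HasBlockBases.dfinsupp {ι : Type*} {κ : ι → Type*} {V W : ι → Type*}
    [DecidableEq ι]
    [∀ i, AddCommGroup (V i)] [∀ i, Module ℂ (V i)] [∀ i, AddCommGroup (W i)]
    [∀ i, Module ℂ (W i)] {f g : ∀ i, V i →ₗ[ℂ] W i} {B : ∀ i, κ i → KroneckerBlock}
    (h : ∀ i, HasBlockBases (f i) (g i) (B i)) :
    HasBlockBases (DFinsupp.mapRange.linearMap f) (DFinsupp.mapRange.linearMap g)
      fun k : Σ i, κ i => B k.1 k.2 := by
  choose v w hvw using h
  refine ⟨(DFinsupp.basis v).reindex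
      (Equiv.sigmaAssoc fun i (k : κ i) => Fin (B i k).cols).symm,
    (DFinsupp.basis w).reindex (Equiv.sigmaAssoc fun i (k : κ i) => Fin (B i k).rows).symm,
    fun ⟨i, k⟩ c => ?_⟩
  have h1 : DFinsupp.basis v ⟨i, k, c⟩ = DFinsupp.single i (v i ⟨k, c⟩) := dfinsupp_basis_apply ..
  have h2 (a) : DFinsupp.basis w ⟨i, k, a⟩ = DFinsupp.single i (w i ⟨k, a⟩) :=
    dfinsupp_basis_apply ..
  simp only [Basis.reindex_apply, Equiv.symm_symm]
  change DFinsupp.mapRange.linearMap f (DFinsupp.basis v ⟨i, k, c⟩) =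
      ∑ a, (B i k).lead a c • DFinsupp.basis w ⟨i, k, a⟩ ∧
    DFinsupp.mapRange.linearMap g (DFinsupp.basis v ⟨i, k, c⟩) =
      ∑ a, (B i k).const a c • DFinsupp.basis w ⟨i, k, a⟩
  simp only [h1, h2, DFinsupp.mapRange.linearMap_apply, DFinsupp.mapRange_single, hvw,
    ← DFinsupp.single_smul]
  simp only [← DFinsupp.singleAddHom_apply, map_sum, and_self]

theorem HasBlockBases.conj {κ V W V' W' : Type*} [AddCommGroup V] [Module ℂ V] [AddCommGroup W]
    [Module ℂ W] [AddCommGroup V'] [Module ℂ V'] [AddCommGroup W']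
    [Module ℂ W'] {f g : V →ₗ[ℂ] W} {f' g' : V' →ₗ[ℂ] W'} {B : κ → KroneckerBlock}
    (h : HasBlockBases f g B) (φ : V ≃ₗ[ℂ] V') (ψ : W ≃ₗ[ℂ] W')
    (hf : ∀ x, f' (φ x) = ψ (f x)) (hg : ∀ x, g' (φ x) = ψ (g x)) : HasBlockBases f' g' B := by
  obtain ⟨v, w, hvw⟩ := h
  refine ⟨v.map φ, w.map ψ, fun k c => ?_⟩
  simp [hf, hg, hvw]

/-- Guarantees that multiplying a nilpotent by a commuting unit does not lower its nilpotency order.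
-/
theorem pow_mul_mul_pow_of_commute {R : Type*} [Monoid R] {t s x : R} (h : t * s = 1)
    (hc : Commute s x) (k : ℕ) : t ^ k * (s * x) ^ k = x ^ k := by
  have : ∀ k : ℕ, t ^ k * s ^ k = 1 := fun k => by
    induction k with
    | zero => simp
    | succ k ih => rw [pow_succ, pow_succ', mul_assoc, ← mul_assoc t s, h, one_mul, ih]
  rw [hc.mul_pow, ← mul_assoc, this, one_mul]

/-- If `μ = 0`, then `z x - 1` is invertible; using it to carry the column basis to the row basis
turns the pair into `((z x - 1)⁻¹ x, 1)`, with nilpotent first entry: a block at infinity. If `μ ≠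
0`, then `x` is invertible and the pair becomes `(1, z - x⁻¹)`, where `z - x⁻¹ = (z - μ⁻¹) + (μ⁻¹ -
x⁻¹)` with nilpotent second summand: a finite block for `z - μ⁻¹`. -/
theorem exists_block_of_pow_eq_zero {U : Type*} [AddCommGroup U] [Module ℂ U]
    [FiniteDimensional ℂ U] (x : End ℂ U) (μ z : ℂ) (e : ℕ+)
    (he : finrank ℂ U = e) (h0 : (x - algebraMap ℂ _ μ) ^ (e : ℕ) = 0)
    (h1 : (x - algebraMap ℂ _ μ) ^ ((e : ℕ) - 1) ≠ 0) :
    ∃ B : KroneckerBlock, HasBlockBases x (z • x - 1) fun _ : Unit => B := by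
  have hn : IsNilpotent (x - algebraMap ℂ _ μ) := ⟨e, h0⟩
  by_cases hμ : μ = 0
  · subst hμ
    simp only [map_zero, sub_zero] at h0 h1 hn
    obtain ⟨s, hts, hst⟩ := isUnit_iff_exists.mp (hn.smul z).isUnit_sub_one
    have hcomm : Commute s x := by
      have h : Commute (z • x - 1) x := ((Commute.refl x).smul_left z).sub_left (Commute.one_left x)
      calc s * x = s * (x * (z • x - 1)) * s := by rw [mul_assoc, mul_assoc, hts, mul_one]
        _ = s * (z • x - 1) * x * s := by rw [← h.eq]; noncomm_ring
        _ = x * s := by rw [hst, one_mul]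
    obtain ⟨v, hv⟩ := exists_basis_of_nilpotent (s * x) he
      (by rw [hcomm.mul_pow, h0, mul_zero]) fun h => h1 (by
        rw [← pow_mul_mul_pow_of_commute hts hcomm, h, mul_zero])
    refine ⟨.infinite e, .infinite e v (v.map (LinearEquiv.ofLinearMap (z • x - 1) s hts hst))
      (fun c => ?_) fun c => rfl⟩
    have : x (v c) = (z • x - 1) ((s * x) (v c)) := by
      rw [← Module.End.mul_apply, ← mul_assoc, hts, one_mul]
    rw [this, hv, map_sum]
    exact Finset.sum_congr rfl fun a _ => map_smul _ _ _
  · obtain ⟨s, hts, hst⟩ : ∃ s, x * s = 1 ∧ s * x = 1 := by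
      have := IsNilpotent.isUnit_add_right_of_commute (u := algebraMap ℂ (End ℂ U) μ) hn
        ((isUnit_iff_ne_zero.mpr hμ).map _) (Algebra.commutes _ _).symm
      exact isUnit_iff_exists.mp (by simpa using this)
    set y := x - algebraMap ℂ _ μ with hy
    have hl : algebraMap ℂ (End ℂ U) μ⁻¹ - s = μ⁻¹ • (s * y) := by
      rw [hy, mul_sub, hst, smul_sub, Algebra.algebraMap_eq_smul_one,
        Algebra.algebraMap_eq_smul_one, mul_smul_comm, mul_one, smul_smul, inv_mul_cancel₀ hμ,
        one_smul]
    have hcomm : Commute s y := by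
      have : Commute s x := hst.trans hts.symm
      exact this.sub_right (Algebra.commutes _ _).symm
    obtain ⟨v, hv⟩ := exists_basis_of_nilpotent (algebraMap ℂ (End ℂ U) μ⁻¹ - s) he
      (by rw [hl, smul_pow, hcomm.mul_pow, h0, mul_zero, smul_zero]) fun h => h1 (by
        rw [hl, smul_pow] at h
        rw [← pow_mul_mul_pow_of_commute hts hcomm,
          (smul_eq_zero.mp h).resolve_left (pow_ne_zero _ (inv_ne_zero hμ)), mul_zero])
    refine ⟨.finite (z - μ⁻¹) e, .finite (z - μ⁻¹) e v (v.map (LinearEquiv.ofLinearMap x s hts hst))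
      (fun c => rfl) fun c => ?_⟩
    have h2 : (z • x - 1) (v c) = (z - μ⁻¹) • x (v c) +
        x ((algebraMap ℂ (End ℂ U) μ⁻¹ - s) (v c)) := by
      have h3 : x (s (v c)) = v c := by
        rw [← Module.End.mul_apply, hts, Module.End.one_apply]
      simp only [LinearMap.sub_apply, LinearMap.smul_apply, Module.End.one_apply, map_sub,
        Module.algebraMap_end_apply, map_smul, h3, sub_smul]
      abel
    rw [h2, hv, map_sum]
    refine congrArg _ (Finset.sum_congr rfl fun a _ => map_smul _ _ _)

/-- Multiplication by `X`. -/
abbrev mulX (U : Type*) [AddCommGroup U] [Module ℂ U] [Module ℂ[X] U] [IsScalarTower ℂ ℂ[X] U] :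
    End ℂ U :=
  Algebra.lsmul ℂ ℂ U (Polynomial.X : ℂ[X])

/-- Over `ℂ` the prime `p` is associated to some `X - μ`, and on the cyclic module `X - μ` is
nilpotent of order exactly `e`, which equals the dimension. For `e = 0` the module is zero and
contributes no block. -/
theorem exists_hasBlockBases_quotient {p : ℂ[X]} (hp : Irreducible p) (e : ℕ) (z : ℂ) :
    ∃ (κ : Type) (_ : Fintype κ) (B : κ → KroneckerBlock),
      HasBlockBases (mulX (ℂ[X] ⧸ Submodule.span ℂ[X] {p ^ e}))
        (z • mulX (ℂ[X] ⧸ Submodule.span ℂ[X] {p ^ e}) - 1) B := by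
  have hfd : finrank ℂ (ℂ[X] ⧸ Submodule.span ℂ[X] {p ^ e}) = e := by
    have := finrank_quotient_span_eq_natDegree (f := p ^ e)
    rw [Polynomial.natDegree_pow, Polynomial.natDegree_eq_of_degree_eq_some
      (n := 1) (IsAlgClosed.degree_eq_one_of_irreducible ℂ hp), mul_one] at this
    exact this
  have hfin : FiniteDimensional ℂ (ℂ[X] ⧸ Submodule.span ℂ[X] {p ^ e}) :=
    (AdjoinRoot.powerBasis (pow_ne_zero e hp.ne_zero)).finite
  rcases Nat.eq_zero_or_pos e with h | h
  · subst h
    have := finrank_zero_iff.mp hfd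
    exact ⟨Empty, inferInstance, Empty.elim, Basis.empty _, Basis.empty _, fun k => k.elim⟩
  obtain ⟨μ, hμ⟩ := IsAlgClosed.exists_root p
    (by rw [IsAlgClosed.degree_eq_one_of_irreducible ℂ hp]; exact one_ne_zero)
  have hass : Associated (Polynomial.X - Polynomial.C μ) p :=
    (Polynomial.irreducible_X_sub_C μ).associated_of_dvd hp (Polynomial.dvd_iff_isRoot.mpr hμ)
  have hl : ∀ k, (mulX (ℂ[X] ⧸ Submodule.span ℂ[X] {p ^ e}) - algebraMap ℂ _ μ) ^ k =
      Algebra.lsmul ℂ ℂ (ℂ[X] ⧸ Submodule.span ℂ[X] {p ^ e})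
        ((Polynomial.X - Polynomial.C μ) ^ k) := fun k => by
    rw [map_pow, map_sub]
    congr 2
    exact (AlgHom.commutes (Algebra.lsmul ℂ ℂ (ℂ[X] ⧸ Submodule.span ℂ[X] {p ^ e})) μ).symm
  obtain ⟨B, hB⟩ := exists_block_of_pow_eq_zero
    (mulX (ℂ[X] ⧸ Submodule.span ℂ[X] {p ^ e})) μ z ⟨e, h⟩ hfd
    (by
      refine (hl e).trans (LinearMap.ext fun y => ?_)
      obtain ⟨y, rfl⟩ := Submodule.Quotient.mk_surjective _ y
      rw [Algebra.lsmul_coe]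
      beta_reduce
      rw [← Submodule.Quotient.mk_smul, LinearMap.zero_apply,
        Submodule.Quotient.mk_eq_zero, Submodule.mem_span_singleton]
      obtain ⟨c, hc⟩ := (hass.pow_pow (n := e)).symm.dvd
      exact ⟨c * y, by rw [hc, smul_eq_mul, smul_eq_mul]; ring⟩)
    (by
      intro h0
      have h1 := LinearMap.congr_fun ((hl (e - 1)).symm.trans h0) (Submodule.Quotient.mk 1)
      rw [Algebra.lsmul_coe] at h1
      beta_reduce at h1
      rw [← Submodule.Quotient.mk_smul, LinearMap.zero_apply,
        Submodule.Quotient.mk_eq_zero, Submodule.mem_span_singleton, smul_eq_mul, mul_one] at h1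
      obtain ⟨c, hc⟩ := h1
      have h2 := (hass.pow_pow (n := e)).dvd.trans (Dvd.intro_left c hc)
      have := (pow_dvd_pow_iff (Polynomial.X_sub_C_ne_zero μ)
        (Polynomial.irreducible_X_sub_C μ).not_isUnit).mp h2
      omega)
  exact ⟨Unit, inferInstance, _, hB⟩

theorem exists_hasBlockBases {V : Type*} [AddCommGroup V] [Module ℂ V] [FiniteDimensional ℂ V]
    (x : End ℂ V) (z : ℂ) :
    ∃ (s : ℕ) (b : Fin s → KroneckerBlock), HasBlockBases x (z • x - 1) b := by
  classical
  obtain ⟨ι, _, p, hp, e, ⟨φ⟩⟩ := Module.equiv_directSum_of_isTorsion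
    (Module.AEval.isTorsion_of_finiteDimensional ℂ V x)
  choose κ hκ B hB using fun i => exists_hasBlockBases_quotient (hp i) (e i) z
  have hB := HasBlockBases.dfinsupp hB
  -- `AEval` is `V` with `X` acting as `x`, so the decomposition carries multiplication by `X` to
  -- `x`.
  let ψ := (φ.restrictScalars ℂ).symm ≪≫ₗ (AEval.of ℂ V x).symm
  have hx : ∀ y, x (ψ y) = ψ ((Polynomial.X : ℂ[X]) • y) := fun y => by
    simp [ψ]
  refine ⟨_, _, (hB.conj ψ ψ (f' := x) (g' := z • x - 1) (fun y => ?_) fun y => ?_).reindex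
    (Fintype.equivFin (Σ i, κ i)).symm⟩
  · rw [hx]; congr 1
  · rw [LinearMap.sub_apply, LinearMap.smul_apply, hx, ← map_smul, Module.End.one_apply, ← map_sub]
    congr 1
    ext i
    simp
    rfl

theorem isKroneckerForm_of_hasBlockBases {m m' : Type*} [Fintype m] [DecidableEq m] [Fintype m']
    [DecidableEq m'] {E A : Matrix m m' ℂ} {s : ℕ} {b : Fin s → KroneckerBlock}
    (h : HasBlockBases (Matrix.toLin' E) (Matrix.toLin' A) b) : IsKroneckerForm E A b := by
  obtain ⟨v, w, h⟩ := h
  -- Any bijection will do: the bases are reindexed along it, and `S`, `T` are the resulting base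
  -- change matrices.
  let er : m ≃ (i : Fin s) × Fin (b i).rows := (Pi.basisFun ℂ m).indexEquiv w
  let ec : m' ≃ (i : Fin s) × Fin (b i).cols := (Pi.basisFun ℂ m').indexEquiv v
  let w' := w.reindex er.symm
  let v' := v.reindex ec.symm
  have key : ∀ (X : Matrix m m' ℂ) (Y : ∀ i, Matrix (Fin (b i).rows) (Fin (b i).cols) ℂ),
      (∀ k c, X.mulVec (v ⟨k, c⟩) = ∑ a, Y k a c • w ⟨k, a⟩) →
      w'.toMatrix (Pi.basisFun ℂ m) * X * (Pi.basisFun ℂ m').toMatrix v' =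
        (Matrix.blockDiagonal' Y).submatrix er ec := by
    intro X Y hXY
    have := basis_toMatrix_mul_linearMap_toMatrix_mul_basis_toMatrix v' (Pi.basisFun ℂ m') w'
      (Pi.basisFun ℂ m) (Matrix.toLin' X)
    have hX : LinearMap.toMatrix (Pi.basisFun ℂ m') (Pi.basisFun ℂ m) (Matrix.toLin' X) = X := by
      ext i j
      simp [LinearMap.toMatrix_apply]
    rw [hX] at this
    rw [this]
    ext i j
    obtain ⟨i, rfl⟩ := er.symm.surjective i
    obtain ⟨j, rfl⟩ := ec.symm.surjective j
    obtain ⟨k, a⟩ := i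
    obtain ⟨l, c⟩ := j
    have hw : ∀ p q, w'.repr (w p) (er.symm q) = Finsupp.single p (1 : ℂ) q := fun p q => by
      rw [Basis.repr_reindex_apply]
      simp
    have hv : v' (ec.symm ⟨l, c⟩) = v ⟨l, c⟩ := by
      simp [v']
    rw [LinearMap.toMatrix_apply, hv, Matrix.toLin'_apply, hXY, Matrix.submatrix_apply,
      Equiv.apply_symm_apply, Equiv.apply_symm_apply, map_sum, Finsupp.coe_finsetSum,
      Finset.sum_apply]
    simp only [map_smul, Finsupp.smul_apply, hw]
    rcases eq_or_ne k l with rfl | hkl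
    · rw [Matrix.blockDiagonal'_apply_eq, Finset.sum_eq_single a]
      · simp
      · intro d _ hd
        rw [Finsupp.single_eq_of_ne (by simpa using hd.symm), smul_zero]
      · simp
    · rw [Matrix.blockDiagonal'_apply_ne _ _ _ hkl, Finset.sum_eq_zero]
      intro d _
      rw [Finsupp.single_eq_of_ne (by simp [hkl]), smul_zero]
  refine ⟨er, ec, w'.toMatrix (Pi.basisFun ℂ m), (Pi.basisFun ℂ m').toMatrix v',
    ?_, ?_, key _ _ fun k c => by simpa using (h k c).1,
    key _ _ fun k c => by simpa using (h k c).2⟩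
  · exact IsUnit.of_mul_eq_one _ (Basis.toMatrix_mul_toMatrix_flip w' (Pi.basisFun ℂ m))
  · exact IsUnit.of_mul_eq_one _ (Basis.toMatrix_mul_toMatrix_flip (Pi.basisFun ℂ m') v')

/-- Every regular pencil has a Kronecker canonical form. -/
theorem PencilIsRegular.exists_isKroneckerForm {m : Type*} [Fintype m] [DecidableEq m]
    {E A : Matrix m m ℂ} (h : PencilIsRegular E A) :
    ∃ (s : ℕ) (b : Fin s → KroneckerBlock), IsKroneckerForm E A b := by
  obtain ⟨z, hz⟩ := h
  -- With `x = F⁻¹ E` one has `E = F x` and `A = F (z x - 1)`, so the pencil is equivalent to the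
  -- pair `(x, z x - 1)`.
  set F := z • E - A with hF
  have hu : IsUnit F.det := isUnit_iff_ne_zero.mpr hz
  obtain ⟨s, b, hb⟩ := exists_hasBlockBases (Matrix.toLin' (F⁻¹ * E)) z
  let ψ := Matrix.toLin'OfInv (Matrix.nonsing_inv_mul F hu) (Matrix.mul_nonsing_inv F hu)
  have hψ : ∀ x, ψ x = F *ᵥ x := fun x => Matrix.toLin'_apply F x
  refine ⟨s, b, isKroneckerForm_of_hasBlockBases (hb.conj (LinearEquiv.refl ℂ _) ψ
    (fun x => ?_) fun x => ?_)⟩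
  · change E *ᵥ x = _
    rw [hψ, Matrix.toLin'_apply, Matrix.mulVec_mulVec, ← mul_assoc, Matrix.mul_nonsing_inv F hu,
      one_mul]
  · change A *ᵥ x = ψ (z • Matrix.toLin' (F⁻¹ * E) x - x)
    rw [hψ, Matrix.toLin'_apply, Matrix.mulVec_sub, Matrix.mulVec_smul, Matrix.mulVec_mulVec,
      ← mul_assoc, Matrix.mul_nonsing_inv F hu, one_mul, hF, Matrix.sub_mulVec, Matrix.smul_mulVec,
      sub_sub_cancel]

end DHQuad

end

noncomputable section

namespace DHQuad

open Module

/-! ### Jordan chains and the Kronecker canonical form -/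

namespace KroneckerBlock

theorem lead_mulVec_right (ε : ℕ) (y : Fin (ε + 1) → ℂ) (i : Fin ε) :
    ((right ε).lead *ᵥ y) i = y i.castSucc := by
  change ∑ j : Fin (ε + 1), (if j.val = i.val then (1 : ℂ) else 0) * y j = _
  rw [Finset.sum_eq_single i.castSucc] <;> simp +contextual [Fin.ext_iff]

theorem const_mulVec_right (ε : ℕ) (y : Fin (ε + 1) → ℂ) (i : Fin ε) :
    ((right ε).const *ᵥ y) i = y i.succ := by
  change ∑ j : Fin (ε + 1), (if j.val = i.val + 1 then (1 : ℂ) else 0) * y j = _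
  rw [Finset.sum_eq_single i.succ] <;> simp +contextual [Fin.ext_iff]

theorem lead_mulVec_left (η : ℕ) (y : Fin η → ℂ) (i : Fin η) :
    ((left η).lead *ᵥ y) i.castSucc = y i := by
  change ∑ j : Fin η, (if i.castSucc.val = j.val then (1 : ℂ) else 0) * y j = _
  rw [Finset.sum_eq_single i] <;> simp +contextual [Fin.ext_iff, eq_comm]

theorem const_mulVec_left (η : ℕ) (y : Fin η → ℂ) (i : Fin η) :
    ((left η).const *ᵥ y) i.succ = y i := by
  change ∑ j : Fin η, (if i.succ.val = j.val + 1 then (1 : ℂ) else 0) * y j = _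
  rw [Finset.sum_eq_single i] <;> simp +contextual [Fin.ext_iff, eq_comm]

theorem lead_finite (lam : ℂ) (ρ : ℕ+) :
    (finite lam ρ).lead = (1 : Matrix (Fin ρ) (Fin ρ) ℂ) := by
  ext (i : Fin ρ) (j : Fin ρ)
  change (if i.val = j.val then (1 : ℂ) else 0) = _
  simp [Matrix.one_apply, Fin.ext_iff]

theorem const_infinite (σ : ℕ+) :
    (infinite σ).const = (1 : Matrix (Fin σ) (Fin σ) ℂ) := by
  ext (i : Fin σ) (j : Fin σ)
  change (if i.val = j.val then (1 : ℂ) else 0) = _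
  simp [Matrix.one_apply, Fin.ext_iff]

theorem lead_finite_mulVec (lam : ℂ) (ρ : ℕ+) (y : Fin ρ → ℂ) :
    (finite lam ρ).lead *ᵥ y = y := by
  rw [lead_finite]; exact Matrix.one_mulVec y

theorem const_infinite_mulVec (σ : ℕ+) (y : Fin σ → ℂ) :
    (infinite σ).const *ᵥ y = y := by
  rw [const_infinite]; exact Matrix.one_mulVec y

theorem sum_ite_mul_single {n : ℕ} (p : Fin n) (a : ℕ) :
    ∑ j : Fin n, (if j.val = a then (1 : ℂ) else 0) * (Pi.single p 1 : Fin n → ℂ) j =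
      if p.val = a then 1 else 0 := by
  rw [Finset.sum_eq_single p] <;> simp +contextual

theorem lead_infinite_mulVec_single (σ : ℕ+) (k : ℕ) (hk : k + 1 < σ) :
    (infinite σ).lead *ᵥ (Pi.single (⟨k + 1, hk⟩ : Fin σ) 1 : Fin σ → ℂ) =
      (Pi.single (⟨k, by omega⟩ : Fin σ) 1 : Fin σ → ℂ) := by
  ext (i : Fin σ)
  change ∑ j : Fin σ, (if j.val = i.val + 1 then (1 : ℂ) else 0) *
    (Pi.single (⟨k + 1, hk⟩ : Fin σ) 1 : Fin σ → ℂ) j = _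
  rw [sum_ite_mul_single]
  simp [Pi.single_apply, Fin.ext_iff, eq_comm]

theorem lead_infinite_mulVec_single_zero (σ : ℕ+) :
    (infinite σ).lead *ᵥ (Pi.single (⟨0, σ.pos⟩ : Fin σ) 1 : Fin σ → ℂ) = 0 := by
  ext (i : Fin σ)
  change ∑ j : Fin σ, (if j.val = i.val + 1 then (1 : ℂ) else 0) *
    (Pi.single (⟨0, σ.pos⟩ : Fin σ) 1 : Fin σ → ℂ) j = 0
  rw [sum_ite_mul_single]
  simp

theorem const_finite_mulVec (lam : ℂ) (ρ : ℕ+) (y : Fin ρ → ℂ) (i : Fin ρ) :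
    ((finite lam ρ).const *ᵥ y) i =
      lam * y i + ∑ j : Fin ρ, (if j.val = i.val + 1 then 1 else 0) * y j := by
  change ∑ j : Fin ρ, (if i.val = j.val then lam else if j.val = i.val + 1 then (1 : ℂ) else 0) *
    y j = _
  have h : ∀ j : Fin ρ, (if i.val = j.val then lam else
      if j.val = i.val + 1 then (1 : ℂ) else 0) * y j =
      (if i = j then lam * y j else 0) + (if j.val = i.val + 1 then 1 else 0) * y j := fun j => by
    rcases eq_or_ne i j with h | h
    · subst h; simp
    · simp [h, Fin.val_inj]
  simp only [h, Finset.sum_add_distrib]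
  simp

theorem const_finite_mulVec_eq_zero {lam : ℂ} (hl : lam ≠ 0) {ρ : ℕ+} {y : Fin ρ → ℂ}
    (h : (finite lam ρ).const *ᵥ y = 0) : y = 0 := by
  -- Back substitution, starting from the last coordinate.
  have key : ∀ m : ℕ, ∀ i : Fin ρ, (ρ : ℕ) - i.val = m → y i = 0 := by
    intro m
    induction m using Nat.strong_induction_on with
    | _ m ih =>
      intro i hi
      have h' := congrFun h i
      rw [const_finite_mulVec, Finset.sum_eq_zero, add_zero] at h'
      · exact (mul_eq_zero.mp h').resolve_left hl
      · intro j _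
        split_ifs with hj
        · rw [ih _ (by have := j.isLt; omega) j rfl, mul_zero]
        · rw [zero_mul]
  exact funext fun i => key _ i rfl

/-- The vector `(1, z, z², …)` works for every `z`; this is why a regular pencil has no such block.
-/
theorem exists_mulVec_eq_of_right {B : KroneckerBlock} {ε : ℕ} (hB : B = right ε) (z : ℂ) :
    ∃ y : Fin B.cols → ℂ, y ≠ 0 ∧ z • (B.lead *ᵥ y) = B.const *ᵥ y := by
  subst hB
  refine ⟨fun j : Fin (ε + 1) => z ^ j.val, fun h => ?_, funext fun (i : Fin ε) => ?_⟩
  · have : z ^ 0 = 0 := congrFun h (0 : Fin (ε + 1))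
    simp at this
  · refine (congrArg (z * ·) (lead_mulVec_right ε _ i)).trans
      (Eq.trans ?_ (const_mulVec_right ε _ i).symm)
    simp [pow_succ, mul_comm]

/-- On left and finite blocks `lead` is injective, so `y₀` would vanish. On an infinite block of
size one `lead` is zero and `const` is the identity, so `h₁` again gives `y₀ = 0`. -/
theorem two_le_infiniteSize {B : KroneckerBlock} (hB : ∀ ε, B ≠ right ε)
    {y₀ y₁ : Fin B.cols → ℂ} (hy : y₀ ≠ 0) (h₀ : B.lead *ᵥ y₀ = 0)
    (h₁ : B.lead *ᵥ y₁ = B.const *ᵥ y₀) : 2 ≤ B.infiniteSize := by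
  cases B with
  | right ε => exact (hB ε rfl).elim
  | left η =>
    refine (hy (funext fun (i : Fin η) => ?_)).elim
    exact (lead_mulVec_left η y₀ i).symm.trans (congrFun h₀ i.castSucc)
  | finite lam ρ => exact (hy ((lead_finite_mulVec lam ρ y₀).symm.trans h₀)).elim
  | infinite σ =>
    by_contra hlt
    have hσ : (σ : ℕ) = 1 := by
      have := σ.pos
      change ¬ 2 ≤ (σ : ℕ) at hlt
      omega
    apply hy
    rw [← const_infinite_mulVec σ y₀]
    refine h₁.symm.trans (funext fun (i : Fin σ) => ?_)
    change ∑ j : Fin σ, (if j.val = i.val + 1 then (1 : ℂ) else 0) * y₁ j = 0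
    refine Finset.sum_eq_zero fun j _ => ?_
    rw [if_neg (by have := j.isLt; omega), zero_mul]

/-- The matrix `const` is injective on every remaining block except a finite one with `lam = 0`. If
that one has size one, `const` is zero and `lead` the identity, so `h₁` forces `y₀ = 0`. -/
theorem not_isStable_of_zero_chain {B : KroneckerBlock} (hB : ∀ ε, B ≠ right ε)
    {y₀ y₁ : Fin B.cols → ℂ} (hy : y₀ ≠ 0) (h₀ : B.const *ᵥ y₀ = 0)
    (h₁ : B.const *ᵥ y₁ = B.lead *ᵥ y₀) : ¬ B.IsStable := by
  cases B with
  | right ε => exact (hB ε rfl).elim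
  | left η =>
    refine (hy (funext fun (i : Fin η) => ?_)).elim
    exact (const_mulVec_left η y₀ i).symm.trans (congrFun h₀ i.succ)
  | infinite σ => exact (hy ((const_infinite_mulVec σ y₀).symm.trans h₀)).elim
  | finite lam ρ =>
    rintro ⟨-, hρ⟩
    rcases eq_or_ne lam 0 with rfl | hl
    · have hρ := congrArg PNat.val (hρ rfl)
      apply hy
      rw [← lead_finite_mulVec 0 ρ y₀]
      refine h₁.symm.trans (funext fun (i : Fin ρ) => (const_finite_mulVec 0 ρ y₁ i).trans ?_)
      rw [zero_mul, zero_add]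
      refine Finset.sum_eq_zero fun j _ => ?_
      rw [if_neg (by have := j.isLt; change (ρ : ℕ) = 1 at hρ; omega), zero_mul]
    · exact hy (const_finite_mulVec_eq_zero hl h₀)

theorem exists_infinite_chain_two {B : KroneckerBlock} (hB : 2 ≤ B.infiniteSize) :
    ∃ y₀ y₁ : Fin B.cols → ℂ, y₀ ≠ 0 ∧ B.lead *ᵥ y₀ = 0 ∧ B.lead *ᵥ y₁ = B.const *ᵥ y₀ := by
  cases B with
  | infinite σ =>
    change 2 ≤ (σ : ℕ) at hB
    refine ⟨(Pi.single (⟨0, σ.pos⟩ : Fin σ) 1 : Fin σ → ℂ),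
      (Pi.single (⟨1, hB⟩ : Fin σ) 1 : Fin σ → ℂ), ?_, lead_infinite_mulVec_single_zero σ, ?_⟩
    · exact Pi.single_ne_zero_iff.mpr one_ne_zero
    · exact (lead_infinite_mulVec_single σ 0 hB).trans (const_infinite_mulVec σ _).symm
  | _ => simp [infiniteSize] at hB

theorem exists_infinite_chain_three {B : KroneckerBlock} (hB : 3 ≤ B.infiniteSize) :
    ∃ y₀ y₁ y₂ : Fin B.cols → ℂ, y₀ ≠ 0 ∧ B.lead *ᵥ y₀ = 0 ∧ B.lead *ᵥ y₁ = B.const *ᵥ y₀ ∧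
      B.lead *ᵥ y₂ = B.const *ᵥ y₁ := by
  cases B with
  | infinite σ =>
    change 3 ≤ (σ : ℕ) at hB
    refine ⟨(Pi.single (⟨0, σ.pos⟩ : Fin σ) 1 : Fin σ → ℂ),
      (Pi.single (⟨1, by omega⟩ : Fin σ) 1 : Fin σ → ℂ),
      (Pi.single (⟨2, hB⟩ : Fin σ) 1 : Fin σ → ℂ), ?_, lead_infinite_mulVec_single_zero σ, ?_, ?_⟩
    · exact Pi.single_ne_zero_iff.mpr one_ne_zero
    · exact (lead_infinite_mulVec_single σ 0 (by omega)).trans (const_infinite_mulVec σ _).symm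
    · exact (lead_infinite_mulVec_single σ 1 hB).trans (const_infinite_mulVec σ _).symm
  | _ => simp [infiniteSize] at hB

theorem const_finite_mulVec_single_zero (lam : ℂ) (ρ : ℕ+) :
    (finite lam ρ).const *ᵥ (Pi.single (⟨0, ρ.pos⟩ : Fin ρ) 1 : Fin ρ → ℂ) =
      lam • (Pi.single (⟨0, ρ.pos⟩ : Fin ρ) 1 : Fin ρ → ℂ) := by
  refine funext fun (i : Fin ρ) => (const_finite_mulVec lam ρ _ i).trans ?_
  rw [sum_ite_mul_single]
  simp

theorem const_finite_mulVec_single_one (lam : ℂ) (ρ : ℕ+) (h : 1 < (ρ : ℕ)) :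
    (finite lam ρ).const *ᵥ (Pi.single (⟨1, h⟩ : Fin ρ) 1 : Fin ρ → ℂ) =
      lam • (Pi.single (⟨1, h⟩ : Fin ρ) 1 : Fin ρ → ℂ) +
        (Pi.single (⟨0, ρ.pos⟩ : Fin ρ) 1 : Fin ρ → ℂ) := by
  refine funext fun (i : Fin ρ) => (const_finite_mulVec lam ρ _ i).trans ?_
  rw [sum_ite_mul_single, Pi.add_apply, Pi.smul_apply, smul_eq_mul]
  congr 1
  rw [Pi.single_apply]
  exact if_congr (by rw [Fin.ext_iff]; change 1 = i.val + 1 ↔ i.val = 0; omega) rfl rfl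

theorem exists_finite_eigenvector {B : KroneckerBlock} {lam : ℂ} {ρ : ℕ+} (hB : B = finite lam ρ) :
    ∃ y : Fin B.cols → ℂ, y ≠ 0 ∧ B.const *ᵥ y = lam • (B.lead *ᵥ y) := by
  subst hB
  exact ⟨(Pi.single (⟨0, ρ.pos⟩ : Fin ρ) 1 : Fin ρ → ℂ), Pi.single_ne_zero_iff.mpr one_ne_zero,
    (const_finite_mulVec_single_zero lam ρ).trans
      (congrArg (lam • ·) (lead_finite_mulVec lam ρ _).symm)⟩

theorem exists_finite_chain {B : KroneckerBlock} {lam : ℂ} {ρ : ℕ+} (hB : B = finite lam ρ)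
    (hρ : ρ ≠ 1) :
    ∃ y₀ y₁ : Fin B.cols → ℂ, y₀ ≠ 0 ∧ B.const *ᵥ y₀ = lam • (B.lead *ᵥ y₀) ∧
      B.const *ᵥ y₁ = lam • (B.lead *ᵥ y₁) + B.lead *ᵥ y₀ := by
  subst hB
  have h2 : 1 < (ρ : ℕ) := by
    have := ρ.pos
    have : (ρ : ℕ) ≠ 1 := fun h => hρ (PNat.eq h)
    omega
  exact ⟨(Pi.single (⟨0, ρ.pos⟩ : Fin ρ) 1 : Fin ρ → ℂ),
    (Pi.single (⟨1, h2⟩ : Fin ρ) 1 : Fin ρ → ℂ), Pi.single_ne_zero_iff.mpr one_ne_zero,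
    (const_finite_mulVec_single_zero lam ρ).trans
      (congrArg (lam • ·) (lead_finite_mulVec lam ρ _).symm),
    (const_finite_mulVec_single_one lam ρ h2).trans
      (congrArg₂ (fun u v => lam • u + v) (lead_finite_mulVec lam ρ _).symm
        (lead_finite_mulVec lam ρ _).symm)⟩

end KroneckerBlock

/-! ### Chains carried between a pencil and its Kronecker form. -/

section Form

variable {m m' : Type*} [Fintype m] [DecidableEq m] [Fintype m'] [DecidableEq m']
  {E A : Matrix m m' ℂ} {s : ℕ} {b : Fin s → KroneckerBlock}

/-- The coordinates are given by `T⁻¹` on the column side and `S` on the row side. They send a chain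
of the pencil to chains of the single blocks. -/
theorem IsKroneckerForm.exists_coordinates (h : IsKroneckerForm E A b) :
    ∃ (φ : (m' → ℂ) ≃ₗ[ℂ] ∀ k, Fin (b k).cols → ℂ) (ψ : (m → ℂ) ≃ₗ[ℂ] ∀ k, Fin (b k).rows → ℂ),
      ∀ x k, ψ (E *ᵥ x) k = (b k).lead *ᵥ φ x k ∧ ψ (A *ᵥ x) k = (b k).const *ᵥ φ x k := by
  obtain ⟨er, ec, S, T, hS, hT, hE, hA⟩ := h
  obtain ⟨S', hS1, hS2⟩ := isUnit_iff_exists.mp hS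
  obtain ⟨T', hT1, hT2⟩ := isUnit_iff_exists.mp hT
  let ψ := Matrix.toLin'OfInv hS2 hS1 ≪≫ₗ LinearEquiv.funCongrLeft ℂ ℂ er.symm ≪≫ₗ
    LinearEquiv.piCurry ℂ fun k (_ : Fin (b k).rows) => ℂ
  let φ := Matrix.toLin'OfInv hT1 hT2 ≪≫ₗ LinearEquiv.funCongrLeft ℂ ℂ ec.symm ≪≫ₗ
    LinearEquiv.piCurry ℂ fun k (_ : Fin (b k).cols) => ℂ
  have key : ∀ (X : Matrix m m' ℂ) (Y : ∀ k, Matrix (Fin (b k).rows) (Fin (b k).cols) ℂ),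
      S * X * T = (Matrix.blockDiagonal' Y).submatrix er ec → ∀ x k, ψ (X *ᵥ x) k =
        Y k *ᵥ φ x k := by
    intro X Y hXY x k
    ext a
    change (S *ᵥ (X *ᵥ x)) (er.symm ⟨k, a⟩) = ∑ c, Y k a c * (T' *ᵥ x) (ec.symm ⟨k, c⟩)
    have : S *ᵥ (X *ᵥ x) = (S * X * T) *ᵥ (T' *ᵥ x) := by
      rw [Matrix.mulVec_mulVec, Matrix.mulVec_mulVec, Matrix.mul_assoc (S * X), hT1, Matrix.mul_one]
    rw [this, hXY]
    simp only [Matrix.mulVec, dotProduct, Matrix.submatrix_apply, Equiv.apply_symm_apply]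
    rw [← ec.symm.sum_comp, Fintype.sum_sigma, Finset.sum_eq_single k]
    · simp
    · intro l _ hl
      refine Finset.sum_eq_zero fun c _ => ?_
      rw [Equiv.apply_symm_apply, Matrix.blockDiagonal'_apply_ne _ _ _ hl.symm, zero_mul]
    · simp
  exact ⟨φ, ψ, fun x k => ⟨key E _ hE x k, key A _ hA x k⟩⟩

/-- The opposite direction: vectors supported on one block lift chains of that block to the pencil.
-/
theorem IsKroneckerForm.exists_embedding (h : IsKroneckerForm E A b) (k : Fin s) :
    ∃ f : (Fin (b k).cols → ℂ) →ₗ[ℂ] (m' → ℂ), ∃ g : (Fin (b k).rows → ℂ) →ₗ[ℂ] (m → ℂ),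
      Function.Injective f ∧
      ∀ y, E *ᵥ f y = g ((b k).lead *ᵥ y) ∧ A *ᵥ f y = g ((b k).const *ᵥ y) := by
  obtain ⟨φ, ψ, hφ⟩ := h.exists_coordinates
  refine ⟨φ.symm.toLinearMap ∘ₗ LinearMap.single ℂ (fun k => Fin (b k).cols → ℂ) k,
    ψ.symm.toLinearMap ∘ₗ LinearMap.single ℂ (fun k => Fin (b k).rows → ℂ) k, ?_, fun y => ⟨?_, ?_⟩⟩
  · exact φ.symm.injective.comp
      (Pi.single_injective (M := fun k => Fin (b k).cols → ℂ) k)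
  · apply ψ.injective
    ext1 l
    simp only [LinearMap.comp_apply, LinearEquiv.coe_coe, LinearEquiv.apply_symm_apply, hφ]
    rcases eq_or_ne l k with rfl | hl
    · simp
    · simp [Pi.single_eq_of_ne hl]
  · apply ψ.injective
    ext1 l
    simp only [LinearMap.comp_apply, LinearEquiv.coe_coe, LinearEquiv.apply_symm_apply, hφ]
    rcases eq_or_ne l k with rfl | hl
    · simp
    · simp [Pi.single_eq_of_ne hl]

theorem IsKroneckerForm.exists_infinite_chain_two (h : IsKroneckerForm E A b) {k : Fin s}
    (hk : 2 ≤ (b k).infiniteSize) :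
    ∃ x₀ x₁ : m' → ℂ, x₀ ≠ 0 ∧ E *ᵥ x₀ = 0 ∧ E *ᵥ x₁ = A *ᵥ x₀ := by
  obtain ⟨f, g, hf, hfg⟩ := h.exists_embedding k
  obtain ⟨y₀, y₁, h0, h1, h2⟩ := KroneckerBlock.exists_infinite_chain_two hk
  refine ⟨f y₀, f y₁, (map_ne_zero_iff f hf).mpr h0, ?_, ?_⟩
  · rw [(hfg _).1, h1, map_zero]
  · rw [(hfg _).1, (hfg _).2, h2]

theorem IsKroneckerForm.exists_infinite_chain_three (h : IsKroneckerForm E A b) {k : Fin s}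
    (hk : 3 ≤ (b k).infiniteSize) :
    ∃ x₀ x₁ x₂ : m' → ℂ, x₀ ≠ 0 ∧ E *ᵥ x₀ = 0 ∧ E *ᵥ x₁ = A *ᵥ x₀ ∧ E *ᵥ x₂ = A *ᵥ x₁ := by
  obtain ⟨f, g, hf, hfg⟩ := h.exists_embedding k
  obtain ⟨y₀, y₁, y₂, h0, h1, h2, h3⟩ := KroneckerBlock.exists_infinite_chain_three hk
  refine ⟨f y₀, f y₁, f y₂, (map_ne_zero_iff f hf).mpr h0, ?_, ?_, ?_⟩
  · rw [(hfg _).1, h1, map_zero]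
  · rw [(hfg _).1, (hfg _).2, h2]
  · rw [(hfg _).1, (hfg _).2, h3]

theorem IsKroneckerForm.exists_finite_eigenvector (h : IsKroneckerForm E A b) {k : Fin s}
    {lam : ℂ} {ρ : ℕ+} (hk : b k = .finite lam ρ) :
    ∃ x : m' → ℂ, x ≠ 0 ∧ A *ᵥ x = lam • (E *ᵥ x) := by
  obtain ⟨f, g, hf, hfg⟩ := h.exists_embedding k
  obtain ⟨y, h0, h1⟩ := KroneckerBlock.exists_finite_eigenvector hk
  refine ⟨f y, (map_ne_zero_iff f hf).mpr h0, ?_⟩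
  rw [(hfg _).1, (hfg _).2, h1, map_smul]

theorem IsKroneckerForm.exists_finite_chain (h : IsKroneckerForm E A b) {k : Fin s}
    {lam : ℂ} {ρ : ℕ+} (hk : b k = .finite lam ρ) (hρ : ρ ≠ 1) :
    ∃ x₀ x₁ : m' → ℂ, x₀ ≠ 0 ∧ A *ᵥ x₀ = lam • (E *ᵥ x₀) ∧
      A *ᵥ x₁ = lam • (E *ᵥ x₁) + E *ᵥ x₀ := by
  obtain ⟨f, g, hf, hfg⟩ := h.exists_embedding k
  obtain ⟨y₀, y₁, h0, h1, h2⟩ := KroneckerBlock.exists_finite_chain hk hρ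
  refine ⟨f y₀, f y₁, (map_ne_zero_iff f hf).mpr h0, ?_, ?_⟩
  · rw [(hfg _).1, (hfg _).2, h1, map_smul]
  · rw [(hfg _).1, (hfg _).2, (hfg _).1, h2, map_add, map_smul]

end Form

/-! ### Index and stability of regular pencils in terms of chains. -/

section Regular

variable {m : Type*} [Fintype m] [DecidableEq m] {E A : Matrix m m ℂ} {s : ℕ}
  {b : Fin s → KroneckerBlock}

theorem PencilIsRegular.ne_right (hr : PencilIsRegular E A) (h : IsKroneckerForm E A b)
    (k : Fin s) (ε : ℕ) : b k ≠ .right ε := by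
  intro hk
  obtain ⟨z, hz⟩ := hr
  obtain ⟨f, g, hf, hfg⟩ := h.exists_embedding k
  obtain ⟨y, h0, h1⟩ := KroneckerBlock.exists_mulVec_eq_of_right hk z
  refine hz (Matrix.exists_mulVec_eq_zero_iff.mp ⟨f y, (map_ne_zero_iff f hf).mpr h0, ?_⟩)
  rw [Matrix.sub_mulVec, Matrix.smul_mulVec, (hfg _).1, (hfg _).2, ← h1, map_smul, sub_self]

theorem PencilIsRegular.exists_two_le_infiniteSize (hr : PencilIsRegular E A)
    (h : IsKroneckerForm E A b) {x₀ x₁ : m → ℂ} (hx : x₀ ≠ 0) (h₀ : E *ᵥ x₀ = 0)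
    (h₁ : E *ᵥ x₁ = A *ᵥ x₀) : ∃ k, 2 ≤ (b k).infiniteSize := by
  obtain ⟨φ, ψ, hφ⟩ := h.exists_coordinates
  obtain ⟨k, hk⟩ : ∃ k, φ x₀ k ≠ 0 := by
    by_contra! hc
    exact hx ((map_eq_zero_iff φ φ.injective).mp (funext hc))
  refine ⟨k, KroneckerBlock.two_le_infiniteSize (hr.ne_right h k) hk (y₁ := φ x₁ k) ?_ ?_⟩
  · rw [← (hφ _ _).1, h₀, map_zero, Pi.zero_apply]
  · rw [← (hφ _ _).1, h₁, (hφ _ _).2]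

theorem PencilIsRegular.exists_not_isStable (hr : PencilIsRegular E A)
    (h : IsKroneckerForm E A b) {x₀ x₁ : m → ℂ} (hx : x₀ ≠ 0) (h₀ : A *ᵥ x₀ = 0)
    (h₁ : A *ᵥ x₁ = E *ᵥ x₀) : ∃ k, ¬ (b k).IsStable := by
  obtain ⟨φ, ψ, hφ⟩ := h.exists_coordinates
  obtain ⟨k, hk⟩ : ∃ k, φ x₀ k ≠ 0 := by
    by_contra! hc
    exact hx ((map_eq_zero_iff φ φ.injective).mp (funext hc))
  refine ⟨k, KroneckerBlock.not_isStable_of_zero_chain (hr.ne_right h k) hk (y₁ := φ x₁ k) ?_ ?_⟩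
  · rw [← (hφ _ _).2, h₀, map_zero, Pi.zero_apply]
  · rw [← (hφ _ _).2, h₁, (hφ _ _).1]

theorem PencilIsRegular.exists_two_le_index (hr : PencilIsRegular E A) {x₀ x₁ : m → ℂ}
    (hx : x₀ ≠ 0) (h₀ : E *ᵥ x₀ = 0) (h₁ : E *ᵥ x₁ = A *ᵥ x₀) :
    ∃ ν, PencilHasIndex E A ν ∧ 1 < ν := by
  obtain ⟨s, b, hb⟩ := hr.exists_isKroneckerForm
  obtain ⟨k, hk⟩ := hr.exists_two_le_infiniteSize hb hx h₀ h₁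
  exact ⟨_, ⟨s, b, hb, rfl⟩, hk.trans
    (Finset.le_sup (f := fun i => (b i).infiniteSize) (Finset.mem_univ k))⟩

theorem not_pencilIsStable_of_infinite_chain {x₀ x₁ : m → ℂ}
    (hx : x₀ ≠ 0) (h₀ : E *ᵥ x₀ = 0) (h₁ : E *ᵥ x₁ = A *ᵥ x₀) : ¬ PencilIsStable E A := by
  rintro ⟨hr, s, b, hb, hst⟩
  obtain ⟨k, hk⟩ := hr.exists_two_le_infiniteSize hb hx h₀ h₁
  have := hst k
  generalize b k = B at *
  cases B with
  | infinite σ =>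
    change σ = 1 at this
    subst this
    exact absurd hk (by decide)
  | _ => simp [KroneckerBlock.infiniteSize] at hk

theorem not_pencilIsStable_of_zero_chain {x₀ x₁ : m → ℂ}
    (hx : x₀ ≠ 0) (h₀ : A *ᵥ x₀ = 0) (h₁ : A *ᵥ x₁ = E *ᵥ x₀) : ¬ PencilIsStable E A := by
  rintro ⟨hr, s, b, hb, hst⟩
  obtain ⟨k, hk⟩ := hr.exists_not_isStable hb hx h₀ h₁
  exact hk (hst k)

theorem PencilHasIndex.exists_infinite_chain_two {ν : ℕ} (h : PencilHasIndex E A ν) (hν : 2 ≤ ν) :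
    ∃ x₀ x₁ : m → ℂ, x₀ ≠ 0 ∧ E *ᵥ x₀ = 0 ∧ E *ᵥ x₁ = A *ᵥ x₀ := by
  obtain ⟨s, b, hb, rfl⟩ := h
  obtain ⟨k, -, hk⟩ := (Finset.le_sup_iff (by decide)).mp hν
  exact hb.exists_infinite_chain_two hk

theorem PencilHasIndex.exists_infinite_chain_three {ν : ℕ} (h : PencilHasIndex E A ν)
    (hν : 3 ≤ ν) :
    ∃ x₀ x₁ x₂ : m → ℂ, x₀ ≠ 0 ∧ E *ᵥ x₀ = 0 ∧ E *ᵥ x₁ = A *ᵥ x₀ ∧ E *ᵥ x₂ = A *ᵥ x₁ := by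
  obtain ⟨s, b, hb, rfl⟩ := h
  obtain ⟨k, -, hk⟩ := (Finset.le_sup_iff (by decide)).mp hν
  exact hb.exists_infinite_chain_three hk

/-- The chain is detected in whichever Kronecker form witnesses `ν`, so the bound holds without
knowing that the index is unique. -/
theorem PencilIsRegular.two_le_index (hr : PencilIsRegular E A) {ν : ℕ}
    (h : PencilHasIndex E A ν) {x₀ x₁ : m → ℂ} (hx : x₀ ≠ 0) (h₀ : E *ᵥ x₀ = 0)
    (h₁ : E *ᵥ x₁ = A *ᵥ x₀) : 2 ≤ ν := by
  obtain ⟨s, b, hb, rfl⟩ := h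
  obtain ⟨k, hk⟩ := hr.exists_two_le_infiniteSize hb hx h₀ h₁
  exact hk.trans (Finset.le_sup (f := fun i => (b i).infiniteSize) (Finset.mem_univ k))

end Regular

end DHQuad

end

noncomputable section

namespace DHQuad

open Module

/-! ### The sesquilinear form of a real matrix -/

section Sesq

variable {n : ℕ}

/-- The complexification of a real matrix. -/
abbrev cmat (X : Matrix (Fin n) (Fin n) ℝ) : Matrix (Fin n) (Fin n) ℂ := X.map Complex.ofReal

/-- The sesquilinear form `u* X v` of a real matrix `X`. -/
def sesq (X : Matrix (Fin n) (Fin n) ℝ) (u v : Fin n → ℂ) : ℂ := star u ⬝ᵥ (cmat X *ᵥ v)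

theorem star_sesq (X : Matrix (Fin n) (Fin n) ℝ) (u v : Fin n → ℂ) :
    star (sesq X u v) = sesq Xᵀ v u := by
  have h : (cmat X)ᴴ = cmat Xᵀ := by
    ext i j
    simp [cmat]
  rw [sesq, sesq, ← Matrix.star_dotProduct_star, star_star, ← h, Matrix.star_mulVec,
    Matrix.dotProduct_mulVec, dotProduct_comm, dotProduct_comm]

theorem sesq_eq_zero_of_ker_right {X : Matrix (Fin n) (Fin n) ℝ} {v : Fin n → ℂ}
    (h : cmat X *ᵥ v = 0) (u : Fin n → ℂ) : sesq X u v = 0 := by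
  rw [sesq, h, dotProduct_zero]

theorem sesq_swap {X : Matrix (Fin n) (Fin n) ℝ} (hX : X.PosSemidef) (u v : Fin n → ℂ) :
    sesq X u v = star (sesq X v u) := by
  rw [star_sesq, show Xᵀ = X from hX.isHermitian]

theorem sesq_swap_skew {X : Matrix (Fin n) (Fin n) ℝ} (hX : Xᵀ = -X) (u v : Fin n → ℂ) :
    sesq X u v = -star (sesq X v u) := by
  rw [star_sesq, hX]
  have : cmat (-X) = -cmat X := by
    ext i j
    simp [cmat]
  rw [sesq, sesq, this, Matrix.neg_mulVec, dotProduct_neg, neg_neg]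

theorem sesq_eq_zero_of_ker_left {X : Matrix (Fin n) (Fin n) ℝ} (hX : X.PosSemidef)
    {u : Fin n → ℂ} (h : cmat X *ᵥ u = 0) (v : Fin n → ℂ) : sesq X u v = 0 := by
  rw [sesq_swap hX, sesq_eq_zero_of_ker_right h, star_zero]

open scoped MatrixOrder ComplexOrder Matrix.Norms.L2Operator in
theorem exists_eq_transpose_mul_self {X : Matrix (Fin n) (Fin n) ℝ} (hX : X.PosSemidef) :
    ∃ B : Matrix (Fin n) (Fin n) ℝ, X = Bᵀ * B := by
  obtain ⟨B, rfl⟩ := CStarAlgebra.nonneg_iff_eq_star_mul_self.mp hX.nonneg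
  exact ⟨B, rfl⟩

/-- Writing `X = Bᵀ * B`, the form at `q` is `‖B q‖²`. Its vanishing gives `B q = 0` and hence `X q
= 0`; this turns scalar identities into kernel membership. -/
theorem exists_sesq_self {X : Matrix (Fin n) (Fin n) ℝ} (hX : X.PosSemidef) (q : Fin n → ℂ) :
    ∃ r : ℝ, 0 ≤ r ∧ sesq X q q = r ∧ (r = 0 → cmat X *ᵥ q = 0) := by
  obtain ⟨B, rfl⟩ := exists_eq_transpose_mul_self hX
  have h : cmat (Bᵀ * B) = (cmat B)ᴴ * cmat B := by
    ext i j
    simp [cmat, Matrix.mul_apply]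
  refine ⟨∑ i, Complex.normSq ((cmat B *ᵥ q) i), Finset.sum_nonneg fun i _ =>
    Complex.normSq_nonneg _, ?_, fun h0 => ?_⟩
  · rw [sesq, h, ← Matrix.mulVec_mulVec, Matrix.dotProduct_mulVec, ← Matrix.star_mulVec]
    simp [dotProduct, Complex.normSq_eq_conj_mul_self]
  · rw [Finset.sum_eq_zero_iff_of_nonneg fun i _ => Complex.normSq_nonneg _] at h0
    have : cmat B *ᵥ q = 0 := funext fun i => Complex.normSq_eq_zero.mp (h0 i (Finset.mem_univ i))
    rw [h, ← Matrix.mulVec_mulVec, this, Matrix.mulVec_zero]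

theorem exists_sesq_self_skew {X : Matrix (Fin n) (Fin n) ℝ} (hX : Xᵀ = -X) (q : Fin n → ℂ) :
    ∃ r : ℝ, sesq X q q = r * Complex.I := by
  refine ⟨(sesq X q q).im, ?_⟩
  have h := congrArg Complex.re (sesq_swap_skew hX q q)
  simp only [Complex.neg_re, Complex.star_def, Complex.conj_re] at h
  apply Complex.ext <;> simp
  linarith

/-- Real matrices annihilate the real and the imaginary part separately, and one of these is
nonzero. -/
theorem haveCommonKernel_of_complex {ι : Type*} {Y : ι → Matrix (Fin n) (Fin n) ℝ}
    {p : Fin n → ℂ} (hp : p ≠ 0) (h : ∀ i, cmat (Y i) *ᵥ p = 0) : HaveCommonKernel Y := by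
  have hre : ∀ i, Y i *ᵥ (fun j => (p j).re) = 0 := fun i => funext fun a => by
    have := congrArg Complex.re (congrFun (h i) a)
    simpa [Matrix.mulVec, dotProduct, cmat] using this
  have him : ∀ i, Y i *ᵥ (fun j => (p j).im) = 0 := fun i => funext fun a => by
    have := congrArg Complex.im (congrFun (h i) a)
    simpa [Matrix.mulVec, dotProduct, cmat] using this
  by_cases h0 : (fun j => (p j).re) = 0
  · refine ⟨_, fun h1 => hp (funext fun j => ?_), him⟩
    exact Complex.ext (congrFun h0 j) (congrFun h1 j)
  · exact ⟨_, h0, hre⟩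

theorem cmat_mulVec_ofReal (X : Matrix (Fin n) (Fin n) ℝ) (v : Fin n → ℝ) :
    cmat X *ᵥ (fun i => (v i : ℂ)) = fun i => ((X *ᵥ v) i : ℂ) := by
  ext i
  simp [Matrix.mulVec, dotProduct, cmat]

theorem ofReal_comp_ne_zero {v : Fin n → ℝ} (hv : v ≠ 0) : (fun i => (v i : ℂ)) ≠ 0 := fun h =>
  hv (funext fun i => by simpa using congrFun h i)

end Sesq

/-! ### The companion pencil -/

section Companion

variable {n : ℕ} (M D K G : Matrix (Fin n) (Fin n) ℝ)

theorem companionLead_mulVec (p q : Fin n → ℂ) :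
    companionLead (quadPoly M D K G) *ᵥ Sum.elim p q = Sum.elim (cmat M *ᵥ p) q := by
  rw [companionLead, Matrix.fromBlocks_map, Matrix.fromBlocks_mulVec]
  simp [quadPoly, Matrix.map_zero, Matrix.map_one, Function.comp_def]

theorem companionConst_mulVec (p q : Fin n → ℂ) :
    companionConst (quadPoly M D K G) *ᵥ Sum.elim p q =
      Sum.elim (cmat G *ᵥ p - cmat D *ᵥ p - cmat K *ᵥ q) p := by
  have h1 : (G - D).map Complex.ofReal = cmat G - cmat D := by
    ext i j; simp [cmat]
  have h2 : (-K).map Complex.ofReal = -cmat K := by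
    ext i j; simp [cmat]
  rw [companionConst, Matrix.fromBlocks_neg, Matrix.fromBlocks_map, Matrix.fromBlocks_mulVec]
  simp [quadPoly, Matrix.map_zero, Matrix.map_one, Function.comp_def, h1, h2, Matrix.sub_mulVec,
    Matrix.neg_mulVec]
  rw [← sub_eq_add_neg]

theorem exists_sum_elim {x : Fin n ⊕ Fin n → ℂ} : ∃ p q, x = Sum.elim p q :=
  ⟨x ∘ Sum.inl, x ∘ Sum.inr, (Sum.elim_comp_inl_inr x).symm⟩

theorem sum_elim_inj {p q p' q' : Fin n → ℂ} (h : Sum.elim p q = Sum.elim p' q') :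
    p = p' ∧ q = q' :=
  ⟨funext fun i => congrFun h (Sum.inl i), funext fun i => congrFun h (Sum.inr i)⟩

variable {M D K G} (hM : M.PosSemidef) (hD : D.PosSemidef) (hK : K.PosSemidef) (hG : Gᵀ = -G)

/-- Evaluation at the single point `λ = 1` retains enough, since the coefficients of `M`, `D`, `K`
are all positive there. -/
theorem isSingular_quadPoly_iff_det :
    IsSingular (quadPoly M D K G) → (M + D + K - G).det = 0 := by
  intro h
  have h1 := congrArg (Polynomial.evalRingHom (1 : ℝ)) h
  rw [RingHom.map_det, map_zero] at h1
  rw [← h1]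
  congr 1
  ext i j
  simp [Fin.sum_univ_three, quadPoly, Polynomial.eval_add]
  ring

include hM hD hK hG

/-- Pairing with `p`, the skew term is purely imaginary, so the real part is a vanishing sum of
three nonnegative numbers. -/
theorem haveCommonKernel_of_mulVec_eq_zero {p : Fin n → ℂ} (hp : p ≠ 0)
    (h : cmat M *ᵥ p + cmat D *ᵥ p + cmat K *ᵥ p - cmat G *ᵥ p = 0) :
    HaveCommonKernel ![M, D, K, G] := by
  obtain ⟨m, hm, hme, hm0⟩ := exists_sesq_self hM p
  obtain ⟨d, hd, hde, hd0⟩ := exists_sesq_self hD p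
  obtain ⟨k, hk, hke, hk0⟩ := exists_sesq_self hK p
  obtain ⟨g, hge⟩ := exists_sesq_self_skew hG p
  have h1 : sesq M p p + sesq D p p + sesq K p p - sesq G p p = 0 := by
    simp only [sesq, ← dotProduct_add, ← dotProduct_sub, h, dotProduct_zero]
  rw [hme, hde, hke, hge] at h1
  have h2 := congrArg Complex.re h1
  simp at h2
  have hM0 := hm0 (by linarith)
  have hD0 := hd0 (by linarith)
  have hK0 := hk0 (by linarith)
  rw [hM0, hD0, hK0] at h
  refine haveCommonKernel_of_complex hp fun i => ?_
  fin_cases i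
  · exact hM0
  · exact hD0
  · exact hK0
  · simpa using h

theorem isSingular_iff : IsSingular (quadPoly M D K G) ↔ HaveCommonKernel ![M, D, K, G] := by
  constructor
  · intro h
    obtain ⟨v, hv, hv0⟩ := Matrix.exists_mulVec_eq_zero_iff.mpr (isSingular_quadPoly_iff_det h)
    refine haveCommonKernel_of_mulVec_eq_zero hM hD hK hG (ofReal_comp_ne_zero hv) ?_
    simp only [cmat_mulVec_ofReal]
    ext i
    have := congrFun hv0 i
    simp only [Matrix.sub_mulVec, Matrix.add_mulVec, Pi.sub_apply, Pi.add_apply,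
      Pi.zero_apply] at this ⊢
    exact_mod_cast this
  · rintro ⟨v, hv, h⟩
    have hMv : M *ᵥ v = 0 := h 0
    have hDv : D *ᵥ v = 0 := h 1
    have hKv : K *ᵥ v = 0 := h 2
    have hGv : G *ᵥ v = 0 := h 3
    refine Matrix.exists_mulVec_eq_zero_iff.mp ⟨fun i => Polynomial.C (v i), fun h0 => hv ?_, ?_⟩
    · ext i
      simpa using congrFun h0 i
    · have hC : ∀ X : Matrix (Fin n) (Fin n) ℝ, X *ᵥ v = 0 →
          X.map Polynomial.C *ᵥ (fun i => Polynomial.C (v i)) = 0 := fun X hX => by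
        ext1 i
        have := congrArg (Polynomial.C : ℝ →+* ℝ[X]) (congrFun hX i)
        simpa [Matrix.mulVec, dotProduct, map_sum] using this
      rw [Matrix.sum_mulVec, Finset.sum_eq_zero]
      intro i _
      rw [Matrix.smul_mulVec, hC, smul_zero]
      fin_cases i
      · exact hKv
      · simp [quadPoly, Matrix.sub_mulVec, hGv, hDv]
      · exact hMv

theorem pencilIsRegular_of_not_haveCommonKernel (h : ¬ HaveCommonKernel ![M, D, K, G]) :
    PencilIsRegular (companionLead (quadPoly M D K G)) (companionConst (quadPoly M D K G)) := by
  refine ⟨1, fun h0 => ?_⟩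
  obtain ⟨x, hx, hx0⟩ := Matrix.exists_mulVec_eq_zero_iff.mpr h0
  obtain ⟨p, q, rfl⟩ := exists_sum_elim (x := x)
  rw [one_smul, Matrix.sub_mulVec, companionLead_mulVec, companionConst_mulVec, sub_eq_zero] at hx0
  -- At `z = 1` the second block row identifies the two halves of the vector, and the first then
  -- says `P(1) p = 0`.
  obtain ⟨h1, rfl⟩ := sum_elim_inj hx0
  refine h (haveCommonKernel_of_mulVec_eq_zero hM hD hK hG (p := q) ?_ ?_)
  · rintro rfl
    exact hx (by ext i; cases i <;> rfl)
  · rw [h1]; abel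

omit hK in
omit hK in
-- The chain says `M p = 0` and `M r = G p - D p`. Pairing with `p` kills the left side, and the
-- real part leaves `p* D p = 0`.
theorem exists_of_infinite_chain {x₀ x₁ : Fin n ⊕ Fin n → ℂ} (hx : x₀ ≠ 0)
    (h₀ : companionLead (quadPoly M D K G) *ᵥ x₀ = 0)
    (h₁ : companionLead (quadPoly M D K G) *ᵥ x₁ = companionConst (quadPoly M D K G) *ᵥ x₀) :
    ∃ p r : Fin n → ℂ, p ≠ 0 ∧ x₀ = Sum.elim p 0 ∧ x₁ = Sum.elim r p ∧ cmat M *ᵥ p = 0 ∧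
      cmat D *ᵥ p = 0 ∧ cmat G *ᵥ p = cmat M *ᵥ r := by
  obtain ⟨p, q, rfl⟩ := exists_sum_elim (x := x₀)
  obtain ⟨r, s, rfl⟩ := exists_sum_elim (x := x₁)
  rw [companionLead_mulVec, ← Sum.elim_zero_zero] at h₀
  obtain ⟨hMp, rfl⟩ := sum_elim_inj h₀
  rw [companionLead_mulVec, companionConst_mulVec] at h₁
  obtain ⟨h1, rfl⟩ := sum_elim_inj h₁
  rw [Matrix.mulVec_zero, sub_zero] at h1
  have hs0 : s ≠ 0 := by
    rintro rfl
    exact hx Sum.elim_zero_zero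
  obtain ⟨d, hd, hde, hd0⟩ := exists_sesq_self hD s
  obtain ⟨g, hge⟩ := exists_sesq_self_skew hG s
  have h2 : sesq M s r = sesq G s s - sesq D s s := by
    simp only [sesq, h1, dotProduct_sub]
  rw [sesq_eq_zero_of_ker_left hM hMp, hge, hde] at h2
  have h3 := congrArg Complex.re h2
  simp at h3
  have hDp := hd0 h3
  exact ⟨s, r, hs0, rfl, rfl, hMp, hDp, by rw [h1, hDp, sub_zero]⟩

omit hK in
theorem haveCommonKernel_of_hasIndex {ν : ℕ} (h : HasIndex (quadPoly M D K G) ν) (hν : 2 ≤ ν) :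
    HaveCommonKernel ![M, D] := by
  obtain ⟨x₀, x₁, hx, h0, h1⟩ := PencilHasIndex.exists_infinite_chain_two h hν
  obtain ⟨p, r, hp, -, -, hMp, hDp, -⟩ := exists_of_infinite_chain hM hD hG hx h0 h1
  refine haveCommonKernel_of_complex hp fun i => ?_
  fin_cases i
  · exact hMp
  · exact hDp

/-- A third chain vector gives `M t = G r - D r - K p`. Pairing with `p` and using `G p = M r`
yields `0 = -r* M r - p* K p`, so `K p = 0` and `G p = M r = 0`: a common kernel of all four
matrices. -/
theorem index_le_two {ν : ℕ} (h : HasIndex (quadPoly M D K G) ν)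
    (hr : ¬ HaveCommonKernel ![M, D, K, G]) : ν ≤ 2 := by
  by_contra! hν
  obtain ⟨x₀, x₁, x₂, hx, h0, h1, h2⟩ := PencilHasIndex.exists_infinite_chain_three h hν
  obtain ⟨p, r, hp, rfl, rfl, hMp, hDp, hGp⟩ := exists_of_infinite_chain hM hD hG hx h0 h1
  obtain ⟨t, w, rfl⟩ := exists_sum_elim (x := x₂)
  rw [companionLead_mulVec, companionConst_mulVec] at h2
  have h3 := (sum_elim_inj h2).1
  obtain ⟨m, hm, hme, hm0⟩ := exists_sesq_self hM r
  obtain ⟨k, hk, hke, hk0⟩ := exists_sesq_self hK p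
  have h4 : sesq M p t = sesq G p r - sesq D p r - sesq K p p := by
    simp only [sesq, h3, dotProduct_sub]
  have h5 : sesq G r p = sesq M r r := by
    simp only [sesq, hGp]
  rw [sesq_eq_zero_of_ker_left hM hMp, sesq_eq_zero_of_ker_left hD hDp, sesq_swap_skew hG, h5, hme,
    hke] at h4
  have h6 := congrArg Complex.re h4
  simp at h6
  refine hr (haveCommonKernel_of_complex hp fun i => ?_)
  fin_cases i
  · exact hMp
  · exact hDp
  · exact hk0 (by linarith)
  · exact hGp.trans (hm0 (by linarith))

theorem re_nonpos_of_eigenvector (h : ¬ HaveCommonKernel ![M, D]) {lam : ℂ} {q : Fin n → ℂ}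
    (hq : q ≠ 0)
    (he : lam • (cmat G *ᵥ q) - lam • (cmat D *ᵥ q) - cmat K *ᵥ q =
      lam • lam • (cmat M *ᵥ q)) : lam.re ≤ 0 := by
  obtain ⟨m, hm, hme, hm0⟩ := exists_sesq_self hM q
  obtain ⟨d, hd, hde, hd0⟩ := exists_sesq_self hD q
  obtain ⟨k, hk, hke, hk0⟩ := exists_sesq_self hK q
  obtain ⟨g, hge⟩ := exists_sesq_self_skew hG q
  have h1 : lam * sesq G q q - lam * sesq D q q - sesq K q q = lam * (lam * sesq M q q) := by
    simp only [sesq, ← smul_eq_mul, ← dotProduct_smul, ← he, dotProduct_sub]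
  rw [hme, hde, hke, hge] at h1
  by_contra! hpos
  have hre := congrArg Complex.re h1
  have him := congrArg Complex.im h1
  simp at hre him
  set x := lam.re
  set y := lam.im
  -- Real part of the scalar equation multiplied by the conjugate of `lam`, which makes the
  -- gyroscopic term purely imaginary. For `x > 0` every summand is nonnegative.
  have h2 : (x ^ 2 + y ^ 2) * d + k * x + m * (x * (x ^ 2 + y ^ 2)) = 0 := by
    linear_combination (-x) * hre - y * him
  have hp : 0 < x ^ 2 + y ^ 2 := by positivity
  have ha : 0 ≤ (x ^ 2 + y ^ 2) * d := by positivity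
  have hb : 0 ≤ k * x := by positivity
  have hc : 0 ≤ m * (x * (x ^ 2 + y ^ 2)) := by positivity
  have hd' : d = 0 := (mul_eq_zero.mp (by linarith : (x ^ 2 + y ^ 2) * d = 0)).resolve_left hp.ne'
  have hm' : m = 0 := (mul_eq_zero.mp (by linarith : m * (x * (x ^ 2 + y ^ 2)) = 0)).resolve_right
    (by positivity)
  refine h (haveCommonKernel_of_complex hq fun i => ?_)
  fin_cases i
  · exact hm0 hm'
  · exact hd0 hd'

/-- The unknown terms in `q₁` are eliminated by comparing the chain equation paired with `q` and the
conjugate of the eigenvalue equation paired with `q₁`; since `lam` is imaginary, these agree in `q₁`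
up to the damping term. If `lam = 0`, the eigenvalue equation gives `K q = 0` and the chain equation
`D q = 0`. If `lam = iy` with `y ≠ 0`, the eigenvalue equation gives `D q = 0`, the comparison gives
`g = 2ym` for `q* G q = ig` and `q* M q = m`, and then `y² m + k = 0`. -/
theorem haveCommonKernel_of_imaginary_chain {lam : ℂ} (hl : lam.re = 0) {q q₁ : Fin n → ℂ}
    (hq : q ≠ 0)
    (he : lam • (cmat G *ᵥ q) - lam • (cmat D *ᵥ q) - cmat K *ᵥ q =
      lam • lam • (cmat M *ᵥ q))
    (hc : cmat G *ᵥ (lam • q₁ + q) - cmat D *ᵥ (lam • q₁ + q) - cmat K *ᵥ q₁ =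
      lam • (cmat M *ᵥ (lam • q₁ + q)) + lam • (cmat M *ᵥ q)) :
    HaveCommonKernel ![M, D] ∨ HaveCommonKernel ![D, K] := by
  obtain ⟨m, hm, hme, hm0⟩ := exists_sesq_self hM q
  obtain ⟨d, hd, hde, hd0⟩ := exists_sesq_self hD q
  obtain ⟨k, hk, hke, hk0⟩ := exists_sesq_self hK q
  obtain ⟨g, hge⟩ := exists_sesq_self_skew hG q
  have h1 : lam * sesq G q q - lam * sesq D q q - sesq K q q = lam * (lam * sesq M q q) := by
    simp only [sesq, ← smul_eq_mul, ← dotProduct_smul, ← he, dotProduct_sub]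
  have h2 : lam * sesq G q₁ q - lam * sesq D q₁ q - sesq K q₁ q =
      lam * (lam * sesq M q₁ q) := by
    simp only [sesq, ← smul_eq_mul, ← dotProduct_smul, ← he, dotProduct_sub]
  have h3 : lam * sesq G q q₁ + sesq G q q - (lam * sesq D q q₁ + sesq D q q) - sesq K q q₁ =
      lam * (lam * sesq M q q₁ + sesq M q q) + lam * sesq M q q := by
    have := congrArg (star q ⬝ᵥ ·) hc
    simp only [Matrix.mulVec_add, Matrix.mulVec_smul, dotProduct_sub, dotProduct_add,
      dotProduct_smul, smul_eq_mul] at this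
    exact this
  have hconj : star lam = -lam := by
    apply Complex.ext <;> simp [hl]
  have h4 : lam * sesq G q q₁ + lam * sesq D q q₁ - sesq K q q₁ = lam * (lam * sesq M q q₁) := by
    have := congrArg star h2
    simp only [star_sub, star_mul', hconj, ← sesq_swap hM, ← sesq_swap hD, ← sesq_swap hK] at this
    rw [sesq_swap_skew hG q q₁]
    linear_combination this
  rw [hme, hde, hke, hge] at h1
  have hre := congrArg Complex.re h1
  have him := congrArg Complex.im h1
  simp [hl] at hre him
  rcases eq_or_ne lam.im 0 with hy | hy
  · have hl0 : lam = 0 := Complex.ext hl hy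
    subst hl0
    have hKq := hk0 (by simpa using hre)
    rw [sesq_eq_zero_of_ker_left hK hKq, hge, hde] at h3
    have := congrArg Complex.re h3
    simp at this
    refine Or.inr (haveCommonKernel_of_complex hq fun i => ?_)
    fin_cases i
    · exact hd0 this
    · exact hKq
  · have hd' : d = 0 := him.resolve_left hy
    have hDq := hd0 hd'
    rw [sesq_eq_zero_of_ker_left hD hDq] at h3 h4
    have h5 : sesq G q q = 2 * lam * sesq M q q + sesq D q q := by
      linear_combination h3 - h4
    rw [hge, hme, hde, hd'] at h5
    have h6 := congrArg Complex.im h5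
    simp [hl] at h6
    have h7 : lam.im ^ 2 * m + k = 0 := by
      rw [h6] at hre
      linear_combination -hre
    have h8 : 0 ≤ lam.im ^ 2 * m := by positivity
    have hm' : m = 0 := (mul_eq_zero.mp (by linarith : lam.im ^ 2 * m = 0)).resolve_left
      (pow_ne_zero _ hy)
    refine Or.inl (haveCommonKernel_of_complex hq fun i => ?_)
    fin_cases i
    · exact hm0 hm'
    · exact hDq

/-- Any Kronecker form serves as witness: a violation of the stability condition in one of its
blocks yields an eigenvector or a chain that produces one of the two excluded common kernels. -/
theorem pencilIsStable_of_not_haveCommonKernel (h1 : ¬ HaveCommonKernel ![M, D])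
    (h2 : ¬ HaveCommonKernel ![D, K]) :
    PencilIsStable (companionLead (quadPoly M D K G)) (companionConst (quadPoly M D K G)) := by
  have hr := pencilIsRegular_of_not_haveCommonKernel hM hD hK hG (fun ⟨v, hv, hv0⟩ =>
    h1 ⟨v, hv, fun i => by fin_cases i; exacts [hv0 0, hv0 1]⟩)
  obtain ⟨s, b, hb⟩ := hr.exists_isKroneckerForm
  refine ⟨hr, s, b, hb, fun k => ?_⟩
  rcases hbk : b k with ε | η | ⟨lam, ρ⟩ | σ
  · trivial
  · trivial
  · refine ⟨?_, fun hl => ?_⟩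
    · obtain ⟨x, hx, he⟩ := hb.exists_finite_eigenvector hbk
      obtain ⟨p, q, rfl⟩ := exists_sum_elim (x := x)
      rw [companionLead_mulVec, companionConst_mulVec] at he
      have hp : p = lam • q := funext fun i => congrFun he (Sum.inr i)
      have he' : _ = lam • (cmat M *ᵥ p) := funext fun i => congrFun he (Sum.inl i)
      subst hp
      refine re_nonpos_of_eigenvector hM hD hK hG h1 (q := q) ?_ ?_
      · rintro rfl
        exact hx (by simp)
      · simpa only [Sum.elim_inl, Matrix.mulVec_smul] using he'
    · by_contra hρ
      obtain ⟨x₀, x₁, hx, he, hc⟩ := hb.exists_finite_chain hbk hρ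
      obtain ⟨p, q, rfl⟩ := exists_sum_elim (x := x₀)
      obtain ⟨p₁, q₁, rfl⟩ := exists_sum_elim (x := x₁)
      rw [companionLead_mulVec, companionConst_mulVec] at he hc
      rw [companionLead_mulVec] at hc
      have hp : p = lam • q := funext fun i => congrFun he (Sum.inr i)
      have he' : _ = lam • (cmat M *ᵥ p) := funext fun i => congrFun he (Sum.inl i)
      have hp1 : p₁ = lam • q₁ + q := funext fun i => congrFun hc (Sum.inr i)
      have hc' : _ = lam • (cmat M *ᵥ p₁) + cmat M *ᵥ p := funext fun i => congrFun hc (Sum.inl i)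
      subst hp hp1
      refine (haveCommonKernel_of_imaginary_chain hM hD hK hG hl (q := q) (q₁ := q₁)
        ?_ ?_ ?_).elim h1 h2
      · rintro rfl
        exact hx (by simp)
      · simpa only [Sum.elim_inl, Matrix.mulVec_smul] using he'
      · simpa only [Sum.elim_inl, Matrix.mulVec_smul] using hc'
  · change σ = 1
    by_contra hσ
    have h2 : 2 ≤ (b k).infiniteSize := by
      rw [hbk]
      have := σ.pos
      have : (σ : ℕ) ≠ 1 := fun h => hσ (PNat.eq h)
      change 2 ≤ (σ : ℕ)
      omega
    obtain ⟨x₀, x₁, hx, h0, h1'⟩ := hb.exists_infinite_chain_two h2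
    obtain ⟨p, r, hp, -, -, hMp, hDp, -⟩ := exists_of_infinite_chain hM hD hG hx h0 h1'
    refine h1 (haveCommonKernel_of_complex hp fun i => ?_)
    fin_cases i
    · exact hMp
    · exact hDp

omit hM hD hK hG

theorem exists_infinite_chain {v r : Fin n → ℝ} (hv : v ≠ 0) (hMv : M *ᵥ v = 0)
    (hDv : D *ᵥ v = 0) (hr : M *ᵥ r = G *ᵥ v) :
    ∃ x₀ x₁ : Fin n ⊕ Fin n → ℂ, x₀ ≠ 0 ∧ companionLead (quadPoly M D K G) *ᵥ x₀ = 0 ∧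
      companionLead (quadPoly M D K G) *ᵥ x₁ = companionConst (quadPoly M D K G) *ᵥ x₀ := by
  refine ⟨Sum.elim (fun i => (v i : ℂ)) 0, Sum.elim (fun i => (r i : ℂ)) (fun i => (v i : ℂ)),
    fun h => ofReal_comp_ne_zero hv (sum_elim_inj (h.trans Sum.elim_zero_zero.symm)).1, ?_, ?_⟩
  · rw [companionLead_mulVec, cmat_mulVec_ofReal, hMv]
    ext i
    cases i <;> simp
  · rw [companionLead_mulVec, companionConst_mulVec, cmat_mulVec_ofReal, cmat_mulVec_ofReal,
      cmat_mulVec_ofReal, hr, hDv]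
    ext i
    cases i <;> simp

theorem exists_zero_chain {v r : Fin n → ℝ} (hv : v ≠ 0) (hDv : D *ᵥ v = 0)
    (hKv : K *ᵥ v = 0) (hr : K *ᵥ r = G *ᵥ v) :
    ∃ x₀ x₁ : Fin n ⊕ Fin n → ℂ, x₀ ≠ 0 ∧ companionConst (quadPoly M D K G) *ᵥ x₀ = 0 ∧
      companionConst (quadPoly M D K G) *ᵥ x₁ = companionLead (quadPoly M D K G) *ᵥ x₀ := by
  refine ⟨Sum.elim 0 (fun i => (v i : ℂ)), Sum.elim (fun i => (v i : ℂ)) (fun i => (r i : ℂ)),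
    fun h => ofReal_comp_ne_zero hv (sum_elim_inj (h.trans Sum.elim_zero_zero.symm)).2, ?_, ?_⟩
  · rw [companionConst_mulVec, cmat_mulVec_ofReal, hKv]
    ext i
    cases i <;> simp
  · rw [companionLead_mulVec, companionConst_mulVec, cmat_mulVec_ofReal, cmat_mulVec_ofReal,
      cmat_mulVec_ofReal, hr, hDv]
    ext i
    cases i <;> simp

end Companion

end DHQuad

end

noncomputable section

namespace DHQuad

/-! ### Frobenius norms of the perturbations `Δ_Y^u` -/

section Frob

variable {n : ℕ}

/-- The squared Frobenius norm of a matrix. -/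
def frobSq (X : Matrix (Fin n) (Fin n) ℝ) : ℝ := ∑ a, ∑ b, X a b ^ 2

theorem frobSq_nonneg (X : Matrix (Fin n) (Fin n) ℝ) : 0 ≤ frobSq X :=
  Finset.sum_nonneg fun _ _ => Finset.sum_nonneg fun _ _ => sq_nonneg _

theorem frobSq_eq_trace (X : Matrix (Fin n) (Fin n) ℝ) : frobSq X = (Xᵀ * X).trace := by
  simp only [frobSq, Matrix.trace, Matrix.diag, Matrix.mul_apply, Matrix.transpose_apply]
  rw [Finset.sum_comm]
  simp [sq]

theorem frobNorm_eq {ι : Type*} [Fintype ι] (Y : ι → Matrix (Fin n) (Fin n) ℝ) :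
    frobNorm Y = √(∑ i, frobSq (Y i)) := rfl

theorem sqNorm_nonneg (v : Fin n → ℝ) : 0 ≤ sqNorm v := by
  unfold sqNorm dotProduct
  exact Finset.sum_nonneg fun i _ => mul_self_nonneg (v i)

theorem sqNorm_pos {v : Fin n → ℝ} (hv : v ≠ 0) : 0 < sqNorm v :=
  lt_of_le_of_ne (sqNorm_nonneg v) fun h => hv (dotProduct_self_eq_zero.mp h.symm)

theorem sqNorm_neg (v : Fin n → ℝ) : sqNorm (-v) = sqNorm v := by
  simp [sqNorm]

theorem ne_zero_of_mem_unitVectors {u : Fin n → ℝ} (hu : u ∈ unitVectors n) : u ≠ 0 := by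
  rintro rfl
  simp [unitVectors, sqNorm] at hu

theorem exists_smul_mem_unitVectors {v : Fin n → ℝ} (hv : v ≠ 0) :
    ∃ c : ℝ, c • v ∈ unitVectors n := by
  refine ⟨(√(sqNorm v))⁻¹, ?_⟩
  have h := sqNorm_pos hv
  change sqNorm _ = 1
  rw [sqNorm, smul_dotProduct, dotProduct_smul, smul_smul, ← mul_inv, Real.mul_self_sqrt h.le,
    smul_eq_mul]
  exact inv_mul_cancel₀ h.ne'

theorem HaveCommonKernel.exists_unit {ι : Type*} {Y : ι → Matrix (Fin n) (Fin n) ℝ}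
    (h : HaveCommonKernel Y) : ∃ u ∈ unitVectors n, ∀ i, Y i *ᵥ u = 0 := by
  obtain ⟨v, hv, hv0⟩ := h
  obtain ⟨c, hc⟩ := exists_smul_mem_unitVectors hv
  exact ⟨_, hc, fun i => by rw [Matrix.mulVec_smul, hv0, smul_zero]⟩

theorem trace_vecMulVec_mul (u w : Fin n → ℝ) (X : Matrix (Fin n) (Fin n) ℝ) :
    (Matrix.vecMulVec u w * X).trace = w ⬝ᵥ (X *ᵥ u) := by
  rw [Matrix.vecMulVec_mul, Matrix.trace_vecMulVec, dotProduct_comm, Matrix.dotProduct_mulVec]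

/-- The form in which `pert` is used: compression by `1 - u uᵀ` visibly preserves semidefiniteness
and skewness and, for unit `u`, annihilates `u`. -/
theorem add_pert (u : Fin n → ℝ) (X : Matrix (Fin n) (Fin n) ℝ) :
    X + pert u X = (1 - Matrix.vecMulVec u u) * X * (1 - Matrix.vecMulVec u u) := by
  rw [pert]; noncomm_ring

theorem vecMulVec_mul_self {u : Fin n → ℝ} (hu : u ∈ unitVectors n) :
    Matrix.vecMulVec u u * Matrix.vecMulVec u u = Matrix.vecMulVec u u := by
  rw [Matrix.vecMulVec_mul_vecMulVec, show u ⬝ᵥ u = 1 from hu]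
  simp

theorem compl_mul_self {u : Fin n → ℝ} (hu : u ∈ unitVectors n) :
    (1 - Matrix.vecMulVec u u) * (1 - Matrix.vecMulVec u u) = 1 - Matrix.vecMulVec u u := by
  rw [sub_mul, mul_sub, mul_sub, vecMulVec_mul_self hu]
  simp

theorem transpose_compl (u : Fin n → ℝ) :
    (1 - Matrix.vecMulVec u u)ᵀ = 1 - Matrix.vecMulVec u u := by
  rw [Matrix.transpose_sub, Matrix.transpose_one, Matrix.transpose_vecMulVec]

theorem compl_mulVec_self {u : Fin n → ℝ} (hu : u ∈ unitVectors n) :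
    (1 - Matrix.vecMulVec u u) *ᵥ u = 0 := by
  rw [Matrix.sub_mulVec, Matrix.one_mulVec, Matrix.vecMulVec_mulVec, show u ⬝ᵥ u = 1 from hu]
  simp

theorem add_pert_mulVec_self {u : Fin n → ℝ} (hu : u ∈ unitVectors n)
    (X : Matrix (Fin n) (Fin n) ℝ) : (X + pert u X) *ᵥ u = 0 := by
  rw [add_pert, ← Matrix.mulVec_mulVec, compl_mulVec_self hu, Matrix.mulVec_zero]

theorem posSemidef_add_pert (u : Fin n → ℝ) {X : Matrix (Fin n) (Fin n) ℝ} (hX : X.PosSemidef) :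
    (X + pert u X).PosSemidef := by
  have := hX.conjTranspose_mul_mul_same (1 - Matrix.vecMulVec u u)
  rwa [Matrix.conjTranspose_eq_transpose_of_trivial, transpose_compl, ← add_pert] at this

theorem transpose_add_pert (u : Fin n → ℝ) {X : Matrix (Fin n) (Fin n) ℝ} (hX : Xᵀ = -X) :
    (X + pert u X)ᵀ = -(X + pert u X) := by
  rw [add_pert, Matrix.transpose_mul, Matrix.transpose_mul, transpose_compl, hX]
  noncomm_ring

theorem frobSq_add_pert {u : Fin n → ℝ} (hu : u ∈ unitVectors n) (X : Matrix (Fin n) (Fin n) ℝ) :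
    frobSq (X + pert u X) =
      frobSq X - sqNorm (X *ᵥ u) - sqNorm (Xᵀ *ᵥ u) + (u ⬝ᵥ (X *ᵥ u)) ^ 2 := by
  set P := Matrix.vecMulVec u u with hP
  have hQ := compl_mul_self hu
  have h1 : frobSq (X + pert u X) = ((1 - P) * (Xᵀ * (1 - P) * X)).trace := by
    rw [frobSq_eq_trace, add_pert, Matrix.transpose_mul, Matrix.transpose_mul, transpose_compl]
    calc ((1 - P) * (Xᵀ * (1 - P)) * ((1 - P) * X * (1 - P))).trace
        = ((1 - P) * (Xᵀ * ((1 - P) * (1 - P)) * X) * (1 - P)).trace := by noncomm_ring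
      _ = (((1 - P) * (1 - P)) * (Xᵀ * ((1 - P) * (1 - P)) * X)).trace := by
          rw [Matrix.trace_mul_comm, ← mul_assoc]
      _ = _ := by rw [hQ]
  have h2 : (1 - P) * (Xᵀ * (1 - P) * X) = Xᵀ * X - P * (Xᵀ * X) - Xᵀ * (P * X) +
      P * (Xᵀ * (P * X)) := by noncomm_ring
  rw [h1, h2, Matrix.trace_add, Matrix.trace_sub, Matrix.trace_sub, ← frobSq_eq_trace,
    Matrix.trace_mul_comm Xᵀ, mul_assoc, hP, trace_vecMulVec_mul, trace_vecMulVec_mul,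
    trace_vecMulVec_mul]
  have e1 : u ⬝ᵥ ((Xᵀ * X) *ᵥ u) = sqNorm (X *ᵥ u) := by
    rw [← Matrix.mulVec_mulVec, Matrix.dotProduct_mulVec, Matrix.vecMul_transpose, sqNorm]
  have e2 : u ⬝ᵥ ((X * Xᵀ) *ᵥ u) = sqNorm (Xᵀ *ᵥ u) := by
    rw [← Matrix.mulVec_mulVec, Matrix.dotProduct_mulVec, ← Matrix.mulVec_transpose, sqNorm]
  have e3 : u ⬝ᵥ ((Xᵀ * (Matrix.vecMulVec u u * X)) *ᵥ u) = (u ⬝ᵥ (X *ᵥ u)) ^ 2 := by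
    rw [← Matrix.mulVec_mulVec, ← Matrix.mulVec_mulVec, Matrix.vecMulVec_mulVec, op_smul_eq_smul,
      Matrix.mulVec_smul, dotProduct_smul, Matrix.dotProduct_mulVec u Xᵀ, Matrix.vecMul_transpose,
      dotProduct_comm (X *ᵥ u) u, smul_eq_mul, sq]
  rw [e1, e2, e3]

/-- Pythagoras: the compression is an orthogonal projection for the trace inner product, and `-pert
u` is the complementary one. -/
theorem frobSq_eq_add {u : Fin n → ℝ} (hu : u ∈ unitVectors n) (X : Matrix (Fin n) (Fin n) ℝ) :
    frobSq X = frobSq (X + pert u X) + frobSq (pert u X) := by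
  have hR : (X + pert u X)ᵀ * (X + pert u X) =
      (1 - Matrix.vecMulVec u u) * (Xᵀ * (X + pert u X)) := by
    rw [add_pert, Matrix.transpose_mul, Matrix.transpose_mul, transpose_compl]
    calc (1 - Matrix.vecMulVec u u) * (Xᵀ * (1 - Matrix.vecMulVec u u)) *
          ((1 - Matrix.vecMulVec u u) * X * (1 - Matrix.vecMulVec u u))
        = (1 - Matrix.vecMulVec u u) * (Xᵀ * ((1 - Matrix.vecMulVec u u) *
          (1 - Matrix.vecMulVec u u)) * X * (1 - Matrix.vecMulVec u u)) := by noncomm_ring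
      _ = _ := by rw [compl_mul_self hu]; noncomm_ring
  have hR2 : (X + pert u X) * (1 - Matrix.vecMulVec u u) = X + pert u X := by
    rw [add_pert, mul_assoc, compl_mul_self hu]
  have h1 : ((X + pert u X)ᵀ * (X + pert u X)).trace = (Xᵀ * (X + pert u X)).trace := by
    rw [hR, Matrix.trace_mul_comm, mul_assoc, hR2]
  have h2 : ((X + pert u X)ᵀ * X).trace = (Xᵀ * (X + pert u X)).trace := by
    rw [← Matrix.trace_transpose, Matrix.transpose_mul, Matrix.transpose_transpose]
  have h3 : (pert u X)ᵀ * pert u X = ((X + pert u X) - X)ᵀ * ((X + pert u X) - X) := by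
    rw [add_sub_cancel_left]
  rw [frobSq_eq_trace, frobSq_eq_trace, frobSq_eq_trace, h3, Matrix.transpose_sub, sub_mul,
    mul_sub, mul_sub, Matrix.trace_sub, Matrix.trace_sub, Matrix.trace_sub, h1, h2]
  ring

theorem frobSq_pert {u : Fin n → ℝ} (hu : u ∈ unitVectors n) (X : Matrix (Fin n) (Fin n) ℝ) :
    frobSq (pert u X) = sqNorm (X *ᵥ u) + sqNorm (Xᵀ *ᵥ u) - (u ⬝ᵥ (X *ᵥ u)) ^ 2 := by
  have h1 := frobSq_eq_add hu X
  have h2 := frobSq_add_pert hu X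
  linarith

theorem frobSq_pert_le {u : Fin n → ℝ} (hu : u ∈ unitVectors n) (X : Matrix (Fin n) (Fin n) ℝ) :
    frobSq (pert u X) ≤ frobSq X := by
  have h1 := frobSq_eq_add hu X
  have h2 := frobSq_nonneg (X + pert u X)
  linarith

/-- The hypotheses say that `Δ` and `-X` agree on `u`, as do their transposes, and the norm of `pert
u` depends on nothing else. So `pert u X` is as large as `pert u Δ`, a projection of `Δ` up to sign.
-/
theorem frobSq_pert_le_of_mulVec {u : Fin n → ℝ} (hu : u ∈ unitVectors n)
    {X Δ : Matrix (Fin n) (Fin n) ℝ} (h : (X + Δ) *ᵥ u = 0) (h' : (X + Δ)ᵀ *ᵥ u = 0) :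
    frobSq (pert u X) ≤ frobSq Δ := by
  refine le_trans (le_of_eq ?_) (frobSq_pert_le hu Δ)
  rw [frobSq_pert hu, frobSq_pert hu]
  rw [Matrix.add_mulVec] at h
  rw [Matrix.transpose_add, Matrix.add_mulVec] at h'
  rw [eq_neg_of_add_eq_zero_left h, eq_neg_of_add_eq_zero_left h', sqNorm_neg, sqNorm_neg,
    dotProduct_neg, neg_sq]

theorem sqNorm_compl_mulVec {u : Fin n → ℝ} (hu : u ∈ unitVectors n) (w : Fin n → ℝ) :
    sqNorm ((1 - Matrix.vecMulVec u u) *ᵥ w) = sqNorm w - (u ⬝ᵥ w) ^ 2 := by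
  rw [sqNorm, Matrix.dotProduct_mulVec, ← Matrix.mulVec_transpose, transpose_compl,
    Matrix.mulVec_mulVec, compl_mul_self hu, Matrix.sub_mulVec, Matrix.one_mulVec,
    Matrix.vecMulVec_mulVec, sub_dotProduct, sqNorm]
  simp [sq]

theorem dotProduct_mulVec_self_skew {X : Matrix (Fin n) (Fin n) ℝ} (hX : Xᵀ = -X)
    (u : Fin n → ℝ) : u ⬝ᵥ (X *ᵥ u) = 0 := by
  have h : u ⬝ᵥ (X *ᵥ u) = -(u ⬝ᵥ (X *ᵥ u)) := by
    conv_lhs => rw [Matrix.dotProduct_mulVec, ← Matrix.mulVec_transpose, hX, Matrix.neg_mulVec,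
      neg_dotProduct, dotProduct_comm]
  linarith

theorem frobSq_pert_symm {u : Fin n → ℝ} (hu : u ∈ unitVectors n) {X : Matrix (Fin n) (Fin n) ℝ}
    (hX : X.PosSemidef) : frobSq (pert u X) =
      2 * sqNorm ((1 - Matrix.vecMulVec u u) *ᵥ (X *ᵥ u)) + (u ⬝ᵥ (X *ᵥ u)) ^ 2 := by
  rw [frobSq_pert hu, sqNorm_compl_mulVec hu, show Xᵀ = X from hX.isHermitian]
  ring

theorem frobSq_pert_skew {u : Fin n → ℝ} (hu : u ∈ unitVectors n) {X : Matrix (Fin n) (Fin n) ℝ}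
    (hX : Xᵀ = -X) : frobSq (pert u X) = 2 * sqNorm (X *ᵥ u) := by
  rw [frobSq_pert hu, hX, Matrix.neg_mulVec, sqNorm_neg, dotProduct_mulVec_self_skew hX]
  ring

theorem dotProduct_sq_le {u : Fin n → ℝ} (hu : u ∈ unitVectors n) (w : Fin n → ℝ) :
    (u ⬝ᵥ w) ^ 2 ≤ sqNorm w := by
  have h1 := sqNorm_compl_mulVec hu w
  have h2 := sqNorm_nonneg ((1 - Matrix.vecMulVec u u) *ᵥ w)
  linarith

end Frob

/-! ### The structured distance to the common kernel -/

section Dist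

variable {n ℓ : ℕ} {Y : Fin (ℓ + 2) → Matrix (Fin n) (Fin n) ℝ}

theorem frobNorm_pert (hY : Y ∈ structTuples n ℓ) {u : Fin n → ℝ} (hu : u ∈ unitVectors n) :
    frobNorm (fun i => pert u (Y i)) = kernelCost Y u := by
  rw [frobNorm_eq, kernelCost, Fin.sum_univ_succ, frobSq_pert_skew hu hY.1]
  simp only [frobSq_pert_symm hu (hY.2 _)]

theorem kernelCost_le (hY : Y ∈ structTuples n ℓ) {Δ : Fin (ℓ + 2) → Matrix (Fin n) (Fin n) ℝ}
    (hΔ : Y + Δ ∈ structTuples n ℓ) {u : Fin n → ℝ} (hu : u ∈ unitVectors n)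
    (h : ∀ i, (Y + Δ) i *ᵥ u = 0) : kernelCost Y u ≤ frobNorm Δ := by
  rw [← frobNorm_pert hY hu, frobNorm_eq, frobNorm_eq]
  refine Real.sqrt_le_sqrt (Finset.sum_le_sum fun i _ => frobSq_pert_le_of_mulVec hu (h i) ?_)
  have h0 := h i
  rw [Pi.add_apply] at h0
  refine Fin.cases ?_ (fun j => ?_) i
  · have : (Y 0 + Δ 0)ᵀ = -(Y 0 + Δ 0) := hΔ.1
    rw [this, Matrix.neg_mulVec]
    exact neg_eq_zero.mpr (h 0)
  · have : (Y j.succ + Δ j.succ)ᵀ = Y j.succ + Δ j.succ := (hΔ.2 j).isHermitian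
    rw [this]
    exact h j.succ

theorem isCompact_unitVectors (n : ℕ) : IsCompact (unitVectors n) := by
  refine (isCompact_closedBall (0 : Fin n → ℝ) 1).of_isClosed_subset ?_ fun u hu => ?_
  · refine isClosed_eq ?_ continuous_const
    unfold sqNorm dotProduct
    fun_prop
  · rw [mem_closedBall_zero_iff, pi_norm_le_iff_of_nonneg zero_le_one]
    intro i
    have h1 : u i * u i ≤ 1 := by
      rw [← show sqNorm u = 1 from hu]
      exact Finset.single_le_sum (f := fun i => u i * u i) (fun j _ => mul_self_nonneg (u j))
        (Finset.mem_univ i)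
    rw [Real.norm_eq_abs]
    exact abs_le_one_iff_mul_self_le_one.mpr h1

theorem unitVectors_nonempty (hn : 1 ≤ n) : (unitVectors n).Nonempty := by
  refine ⟨Pi.single ⟨0, hn⟩ 1, ?_⟩
  simp [unitVectors, sqNorm]

theorem continuous_kernelCost (Y : Fin (ℓ + 2) → Matrix (Fin n) (Fin n) ℝ) :
    Continuous (kernelCost Y) := by
  unfold kernelCost sqNorm
  fun_prop

/-- The cost attains its minimum on the compact sphere, where `pert u` realizes it. Every admissible
`Δ` is at least as expensive as the cost at a unit vector of its common kernel. -/
theorem exists_minimizer (hn : 1 ≤ n) (hY : Y ∈ structTuples n ℓ) :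
    ∃ u ∈ unitVectors n, kernelCost Y u = distCommonKernel Y ∧
      ∀ w ∈ unitVectors n, distCommonKernel Y ≤ kernelCost Y w := by
  obtain ⟨u, hu, hmin⟩ := (isCompact_unitVectors n).exists_isMinOn (unitVectors_nonempty hn)
    (continuous_kernelCost Y).continuousOn
  have hleast : IsLeast (frobNorm '' {Δ | Y + Δ ∈ structTuples n ℓ ∧ HaveCommonKernel (Y + Δ)})
      (kernelCost Y u) := by
    refine ⟨⟨fun i => pert u (Y i), ⟨⟨transpose_add_pert u hY.1, fun i =>
      posSemidef_add_pert u (hY.2 i)⟩, u, ne_zero_of_mem_unitVectors hu, fun i =>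
      add_pert_mulVec_self hu (Y i)⟩, frobNorm_pert hY hu⟩, ?_⟩
    rintro _ ⟨Δ, ⟨hΔ, hc⟩, rfl⟩
    obtain ⟨w, hw, hw0⟩ := hc.exists_unit
    exact (hmin hw).trans (kernelCost_le hY hΔ hw hw0)
  have heq : distCommonKernel Y = kernelCost Y u := hleast.csInf_eq
  exact ⟨u, hu, heq.symm, fun w hw => heq ▸ hmin hw⟩

theorem isLeast_kernelCost (hn : 1 ≤ n) (hY : Y ∈ structTuples n ℓ) :
    IsLeast (kernelCost Y '' unitVectors n) (distCommonKernel Y) := by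
  obtain ⟨u, hu, h1, h2⟩ := exists_minimizer hn hY
  exact ⟨⟨u, hu, h1⟩, by rintro _ ⟨w, hw, rfl⟩; exact h2 w hw⟩

theorem distCommonKernel_le
    {Δ : Fin (ℓ + 2) → Matrix (Fin n) (Fin n) ℝ} (hΔ : Y + Δ ∈ structTuples n ℓ)
    (hc : HaveCommonKernel (Y + Δ)) : distCommonKernel Y ≤ frobNorm Δ :=
  csInf_le ⟨0, by rintro _ ⟨_, _, rfl⟩; exact Real.sqrt_nonneg _⟩ ⟨Δ, ⟨hΔ, hc⟩, rfl⟩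

/-! ### The smallest eigenvalue -/

theorem exists_lambdaMin (hn : 1 ≤ n) {S : Matrix (Fin n) (Fin n) ℝ} (hS : S.IsHermitian) :
    (∃ u ∈ unitVectors n, u ⬝ᵥ (S *ᵥ u) = lambdaMin S) ∧
      ∀ u ∈ unitVectors n, lambdaMin S ≤ u ⬝ᵥ (S *ᵥ u) := by
  have hfin : (spectrum ℝ S).Finite := Matrix.finite_real_spectrum
  have hne : (spectrum ℝ S).Nonempty := ⟨_, hS.eigenvalues_mem_spectrum_real ⟨0, hn⟩⟩
  constructor
  · have hmem : lambdaMin S ∈ spectrum ℝ S := hne.csInf_mem hfin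
    have hdet : (algebraMap ℝ (Matrix (Fin n) (Fin n) ℝ) (lambdaMin S) - S).det = 0 := by
      by_contra h
      exact hmem ((Matrix.isUnit_iff_isUnit_det _).mpr (isUnit_iff_ne_zero.mpr h))
    obtain ⟨v, hv, hv0⟩ := Matrix.exists_mulVec_eq_zero_iff.mpr hdet
    obtain ⟨c, hc⟩ := exists_smul_mem_unitVectors hv
    refine ⟨_, hc, ?_⟩
    rw [Matrix.sub_mulVec, sub_eq_zero, Algebra.algebraMap_eq_smul_one, Matrix.smul_mulVec,
      Matrix.one_mulVec] at hv0
    rw [Matrix.mulVec_smul, ← hv0, smul_comm, dotProduct_smul, show c • v ⬝ᵥ c • v = 1 from hc]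
    simp
  · intro u hu
    -- Shifting by the least eigenvalue makes the spectrum nonnegative, which is the Rayleigh bound.
    have hpsd : (S - algebraMap ℝ (Matrix (Fin n) (Fin n) ℝ) (lambdaMin S)).PosSemidef := by
      rw [Matrix.posSemidef_iff_isHermitian_and_spectrum_nonneg]
      refine ⟨hS.sub ?_, fun x hx => ?_⟩
      · rw [Algebra.algebraMap_eq_smul_one]
        simp [Matrix.IsHermitian]
      · rw [← spectrum.sub_singleton_eq] at hx
        obtain ⟨y, hy, z, rfl, rfl⟩ := hx
        exact sub_nonneg.mpr (csInf_le hfin.bddBelow hy)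
    have := hpsd.dotProduct_mulVec_nonneg u
    rw [Matrix.sub_mulVec, Algebra.algebraMap_eq_smul_one, Matrix.smul_mulVec, Matrix.one_mulVec,
      dotProduct_sub, dotProduct_smul] at this
    have hu' : star u ⬝ᵥ u = 1 := hu
    rw [hu', star_trivial, smul_eq_mul, mul_one] at this
    linarith

/-- For unit `u`, a symmetric `X` contributes `2‖X u‖² - (uᵀ X u)²`, which lies between `‖X u‖²` and
`2‖X u‖²` by Cauchy–Schwarz. The upper bound is tested at an eigenvector for the least eigenvalue.
-/
theorem lambdaMin_bounds (hn : 1 ≤ n) (hY : Y ∈ structTuples n ℓ)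
    {S : Matrix (Fin n) (Fin n) ℝ} (hS : S.IsHermitian)
    (h : ∀ u, u ⬝ᵥ (S *ᵥ u) = ∑ i, sqNorm (Y i *ᵥ u)) :
    √(lambdaMin S) ≤ distCommonKernel Y ∧ distCommonKernel Y ≤ √(2 * lambdaMin S) := by
  obtain ⟨⟨w, hw, hw1⟩, hmin⟩ := exists_lambdaMin hn hS
  obtain ⟨u, hu, hu1, hu2⟩ := exists_minimizer hn hY
  constructor
  · rw [← hu1, kernelCost]
    refine Real.sqrt_le_sqrt ((hmin u hu).trans ?_)
    rw [h, Fin.sum_univ_succ]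
    refine add_le_add (by linarith [sqNorm_nonneg (Y 0 *ᵥ u)]) (Finset.sum_le_sum fun i _ => ?_)
    rw [sqNorm_compl_mulVec hu]
    linarith [dotProduct_sq_le hu (Y i.succ *ᵥ u)]
  · refine (hu2 w hw).trans (Real.sqrt_le_sqrt ?_)
    rw [← hw1, h, Fin.sum_univ_succ (fun i => sqNorm (Y i *ᵥ w)), mul_add, Finset.mul_sum]
    refine add_le_add le_rfl (Finset.sum_le_sum fun i _ => ?_)
    rw [sqNorm_compl_mulVec hw]
    linarith [sq_nonneg (w ⬝ᵥ (Y i.succ *ᵥ w))]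

end Dist

end DHQuad

end

noncomputable section

namespace DHQuad

/-! ### Approximation by polynomials of high index and by unstable polynomials -/

section Closure

open Filter Topology

variable {n : ℕ}

theorem posSemidef_compl {v : Fin n → ℝ} (hv : v ∈ unitVectors n) :
    (1 - Matrix.vecMulVec v v).PosSemidef := by
  have := Matrix.posSemidef_conjTranspose_mul_self (1 - Matrix.vecMulVec v v)
  rwa [Matrix.conjTranspose_eq_transpose_of_trivial, transpose_compl, compl_mul_self hv] at this

theorem posDef_add_smul_one {X : Matrix (Fin n) (Fin n) ℝ} (hX : X.PosSemidef) {ε : ℝ}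
    (hε : 0 < ε) : (X + ε • (1 : Matrix (Fin n) (Fin n) ℝ)).PosDef :=
  Matrix.PosDef.posSemidef_add hX (Matrix.PosDef.one.smul hε)

theorem posSemidef_add_smul_compl {X : Matrix (Fin n) (Fin n) ℝ} (hX : X.PosSemidef)
    {v : Fin n → ℝ} (hv : v ∈ unitVectors n) {ε : ℝ} (hε : 0 ≤ ε) :
    (X + ε • (1 - Matrix.vecMulVec v v)).PosSemidef :=
  hX.add ((posSemidef_compl hv).smul hε)

theorem add_smul_compl_mulVec_self {X : Matrix (Fin n) (Fin n) ℝ}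
    {v : Fin n → ℝ} (hv : v ∈ unitVectors n) (hXv : X *ᵥ v = 0) (ε : ℝ) :
    (X + ε • (1 - Matrix.vecMulVec v v)) *ᵥ v = 0 := by
  rw [Matrix.add_mulVec, Matrix.smul_mulVec, compl_mulVec_self hv, hXv, smul_zero, add_zero]

/-- The matrix agrees on the orthogonal complement of `v` with the invertible `X + ε`. That one is
symmetric with eigenvector `v`, so it maps the complement onto itself. -/
theorem exists_add_smul_compl_mulVec_eq {X : Matrix (Fin n) (Fin n) ℝ} (hX : X.PosSemidef)
    {v w : Fin n → ℝ} (hXv : X *ᵥ v = 0) (hvw : v ⬝ᵥ w = 0) {ε : ℝ}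
    (hε : 0 < ε) : ∃ r, (X + ε • (1 - Matrix.vecMulVec v v)) *ᵥ r = w := by
  have hdet := (Matrix.isUnit_iff_isUnit_det _).mp (posDef_add_smul_one hX hε).isUnit
  set Z := X + ε • (1 : Matrix (Fin n) (Fin n) ℝ) with hZ
  have hr : Z *ᵥ (Z⁻¹ *ᵥ w) = w := by
    rw [Matrix.mulVec_mulVec, Matrix.mul_nonsing_inv _ hdet, Matrix.one_mulVec]
  set r := Z⁻¹ *ᵥ w
  have hZv : Z *ᵥ v = ε • v := by
    rw [hZ, Matrix.add_mulVec, hXv, Matrix.smul_mulVec, Matrix.one_mulVec, zero_add]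
  have hZt : Zᵀ = Z := (posDef_add_smul_one hX hε).isHermitian
  have hvr : v ⬝ᵥ r = 0 := by
    have h : v ⬝ᵥ (Z *ᵥ r) = ε * (v ⬝ᵥ r) := by
      rw [Matrix.dotProduct_mulVec, ← Matrix.mulVec_transpose, hZt, hZv, smul_dotProduct,
        smul_eq_mul]
    rw [hr, hvw] at h
    exact (mul_eq_zero.mp h.symm).resolve_left hε.ne'
  refine ⟨r, ?_⟩
  have : X + ε • (1 - Matrix.vecMulVec v v) = Z - ε • Matrix.vecMulVec v v := by
    rw [hZ, smul_sub]; abel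
  rw [this, Matrix.sub_mulVec, hr, Matrix.smul_mulVec, Matrix.vecMulVec_mulVec, hvr]
  simp

theorem mem_closure_of_forall_pos {Z : Type*} [TopologicalSpace Z] {S : Set Z} {f : ℝ → Z}
    (hf : Continuous f) (h : ∀ ε, 0 < ε → f ε ∈ S) {P : Z} (hP : f 0 = P) : P ∈ closure S := by
  rw [← hP]
  exact mem_closure_of_tendsto ((hf.tendsto 0).mono_left nhdsWithin_le_nhds)
    (eventually_mem_nhdsWithin.mono fun ε (hε : ε ∈ Set.Ioi 0) => h ε hε)

/-- Kernel vectors may be normalized, so the set is the projection of a closed set along the compact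
unit sphere. -/
theorem isClosed_setOf_haveCommonKernel (ι : Type*) [Finite ι] :
    IsClosed {Y : ι → Matrix (Fin n) (Fin n) ℝ | HaveCommonKernel Y} := by
  have : CompactSpace (unitVectors n) := isCompact_iff_compactSpace.mp (isCompact_unitVectors n)
  have h : IsClosed {p : unitVectors n × (ι → Matrix (Fin n) (Fin n) ℝ) |
      ∀ i, p.2 i *ᵥ p.1.1 = 0} := by
    simp only [Set.ofPred_forall]
    exact isClosed_iInter fun i => isClosed_eq (by fun_prop) continuous_const
  convert isClosedMap_snd_of_compactSpace _ h using 1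
  ext Y
  constructor
  · intro hY
    obtain ⟨u, hu, hu0⟩ := HaveCommonKernel.exists_unit hY
    exact ⟨⟨⟨u, hu⟩, Y⟩, hu0, rfl⟩
  · rintro ⟨⟨u, Y'⟩, hu, rfl⟩
    exact ⟨u.1, ne_zero_of_mem_unitVectors u.2, hu⟩

theorem haveCommonKernel_pair {X Y : Matrix (Fin n) (Fin n) ℝ} :
    HaveCommonKernel ![X, Y] ↔ ∃ v, v ≠ 0 ∧ X *ᵥ v = 0 ∧ Y *ᵥ v = 0 := by
  simp [HaveCommonKernel, Fin.forall_fin_two]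

theorem haveCommonKernel_zero_pair {X Y : Matrix (Fin n) (Fin n) ℝ} :
    HaveCommonKernel ![0, X, Y] ↔ HaveCommonKernel ![X, Y] := by
  simp [HaveCommonKernel, Fin.forall_fin_succ]

theorem haveCommonKernel_pair_two_smul {X Y : Matrix (Fin n) (Fin n) ℝ} :
    HaveCommonKernel ![X, (2 : ℝ) • Y] ↔ HaveCommonKernel ![X, Y] := by
  simp [haveCommonKernel_pair, Matrix.smul_mulVec]

theorem haveCommonKernel_pair_comm {X Y : Matrix (Fin n) (Fin n) ℝ} :
    HaveCommonKernel ![X, Y] ↔ HaveCommonKernel ![Y, X] := by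
  simp [haveCommonKernel_pair, and_comm]

/-- Recovers `D` continuously from the middle coefficient, so the kernel conditions become closed
conditions on the polynomial itself. -/
theorem quadPoly_symm_part {M D K G : Matrix (Fin n) (Fin n) ℝ} (hD : D.PosSemidef)
    (hG : Gᵀ = -G) :
    quadPoly M D K G 1 + (quadPoly M D K G 1)ᵀ = (2 : ℝ) • D := by
  have hDt : Dᵀ = D := hD.isHermitian
  simp only [quadPoly, Matrix.cons_val_one, Matrix.cons_val_zero, Matrix.transpose_neg,
    Matrix.transpose_sub, hDt, hG]
  rw [two_smul]
  abel

theorem isClosed_setOf_haveCommonKernel_comp {j : Fin 3} :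
    IsClosed {P : Fin 3 → Matrix (Fin n) (Fin n) ℝ | HaveCommonKernel ![P j, P 1 + (P 1)ᵀ]} := by
  refine (isClosed_setOf_haveCommonKernel (Fin 2)).preimage
    (f := fun P : Fin 3 → Matrix (Fin n) (Fin n) ℝ => ![P j, P 1 + (P 1)ᵀ]) ?_
  refine continuous_pi fun i => ?_
  fin_cases i
  · exact continuous_apply j
  · exact (continuous_apply 1).add (continuous_apply 1).matrix_transpose

theorem haveCommonKernel_of_regularHighIndex {P : Fin 3 → Matrix (Fin n) (Fin n) ℝ}
    (h : P ∈ regularHighIndex n) : HaveCommonKernel ![P 2, P 1 + (P 1)ᵀ] := by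
  obtain ⟨⟨M, D, K, G, hM, hD, hK, hG, rfl⟩, -, ν, hν, h1⟩ := h
  rw [quadPoly_symm_part hD hG, haveCommonKernel_pair_two_smul]
  exact haveCommonKernel_of_hasIndex hM hD hG hν h1

theorem haveCommonKernel_of_unstable {M D K G : Matrix (Fin n) (Fin n) ℝ} (hM : M.PosSemidef)
    (hD : D.PosSemidef) (hK : K.PosSemidef) (hG : Gᵀ = -G) (h : IsUnstable (quadPoly M D K G)) :
    HaveCommonKernel ![M, D] ∨ HaveCommonKernel ![D, K] := by
  by_contra! hc
  exact h (pencilIsStable_of_not_haveCommonKernel hM hD hK hG hc.1 hc.2)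

theorem haveCommonKernel_of_mem_unstableSet {P : Fin 3 → Matrix (Fin n) (Fin n) ℝ}
    (h : P ∈ unstableSet n) :
    HaveCommonKernel ![P 2, P 1 + (P 1)ᵀ] ∨ HaveCommonKernel ![P 0, P 1 + (P 1)ᵀ] := by
  obtain ⟨⟨M, D, K, G, hM, hD, hK, hG, rfl⟩, h1⟩ := h
  rw [quadPoly_symm_part hD hG, haveCommonKernel_pair_two_smul, haveCommonKernel_pair_two_smul,
    haveCommonKernel_pair_comm (X := quadPoly M D K G 0)]
  exact haveCommonKernel_of_unstable hM hD hK hG h1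

theorem regularHighIndex_subset_unstableSet : regularHighIndex n ⊆ unstableSet n := by
  rintro P ⟨hP, -, ν, hν, h1⟩
  obtain ⟨x₀, x₁, hx, h0, h1⟩ := PencilHasIndex.exists_infinite_chain_two hν h1
  exact ⟨hP, not_pencilIsStable_of_infinite_chain hx h0 h1⟩

theorem continuous_quadPoly {f₁ f₂ f₃ f₄ : ℝ → Matrix (Fin n) (Fin n) ℝ} (h₁ : Continuous f₁)
    (h₂ : Continuous f₂) (h₃ : Continuous f₃) (h₄ : Continuous f₄) :
    Continuous fun ε => quadPoly (f₁ ε) (f₂ ε) (f₃ ε) (f₄ ε) := by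
  refine continuous_pi fun i => ?_
  fin_cases i
  · exact h₃
  · exact (h₄.sub h₂).neg
  · exact h₁

variable {M D K G : Matrix (Fin n) (Fin n) ℝ} (hM : M.PosSemidef) (hD : D.PosSemidef)
  (hK : K.PosSemidef) (hG : Gᵀ = -G)

include hM hD hK hG

theorem index_eq_two {ν : ℕ} (h : HasIndex (quadPoly M D K G) ν)
    (hs : ¬ IsSingular (quadPoly M D K G)) (hex : ∃ ν, HasIndex (quadPoly M D K G) ν ∧ 1 < ν) :
    ν = 2 := by
  rw [isSingular_iff hM hD hK hG] at hs
  obtain ⟨ν', hν', h1⟩ := hex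
  obtain ⟨x₀, x₁, hx, h0, h1⟩ := PencilHasIndex.exists_infinite_chain_two hν' h1
  exact le_antisymm (index_le_two hM hD hK hG h hs)
    ((pencilIsRegular_of_not_haveCommonKernel hM hD hK hG hs).two_le_index h hx h0 h1)

theorem mem_closure_regularHighIndex_of_haveCommonKernel (h : HaveCommonKernel ![M, D]) :
    quadPoly M D K G ∈ closure (regularHighIndex n) := by
  obtain ⟨v, hv, hv0⟩ := h.exists_unit
  have hMv : M *ᵥ v = 0 := hv0 0
  have hDv : D *ᵥ v = 0 := hv0 1
  -- The change of `M` keeps `v` in its kernel and brings `G v` into its range; the change of `K`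
  -- makes it definite and so excludes singularity.
  refine mem_closure_of_forall_pos
    (f := fun ε : ℝ => quadPoly (M + ε • (1 - Matrix.vecMulVec v v)) D (K + ε • 1) G)
    (continuous_quadPoly (by fun_prop) (by fun_prop) (by fun_prop) (by fun_prop))
    (fun ε hε => ?_) (by simp)
  have hM' := posSemidef_add_smul_compl hM hv hε.le
  have hK' := posDef_add_smul_one hK hε
  have hns : ¬ HaveCommonKernel ![M + ε • (1 - Matrix.vecMulVec v v), D, K + ε • 1, G] := by
    rintro ⟨w, hw, hw0⟩
    have hK0 : (K + ε • 1) *ᵥ w = 0 := hw0 2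
    have := hK'.dotProduct_mulVec_pos hw
    rw [hK0, dotProduct_zero] at this
    exact this.false
  obtain ⟨r, hr⟩ := exists_add_smul_compl_mulVec_eq hM hMv (dotProduct_mulVec_self_skew hG v) hε
  obtain ⟨x₀, x₁, hx, h0, h1⟩ := exists_infinite_chain (K := K + ε • 1)
    (ne_zero_of_mem_unitVectors hv)
    (add_smul_compl_mulVec_self hv hMv ε) hDv hr
  exact ⟨⟨_, _, _, _, hM', hD, hK'.posSemidef, hG, rfl⟩,
    fun hs => hns ((isSingular_iff hM' hD hK'.posSemidef hG).mp hs),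
    (pencilIsRegular_of_not_haveCommonKernel hM' hD hK'.posSemidef hG hns).exists_two_le_index
      hx h0 h1⟩

theorem mem_closure_unstableSet_of_haveCommonKernel (h : HaveCommonKernel ![D, K]) :
    quadPoly M D K G ∈ closure (unstableSet n) := by
  obtain ⟨v, hv, hv0⟩ := h.exists_unit
  have hDv : D *ᵥ v = 0 := hv0 0
  have hKv : K *ᵥ v = 0 := hv0 1
  -- Here regularity need not be arranged, since singular polynomials count as unstable.
  refine mem_closure_of_forall_pos
    (f := fun ε : ℝ => quadPoly M D (K + ε • (1 - Matrix.vecMulVec v v)) G)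
    (continuous_quadPoly (by fun_prop) (by fun_prop) (by fun_prop) (by fun_prop))
    (fun ε hε => ?_) (by simp)
  have hK' := posSemidef_add_smul_compl hK hv hε.le
  obtain ⟨r, hr⟩ := exists_add_smul_compl_mulVec_eq hK hKv (dotProduct_mulVec_self_skew hG v) hε
  obtain ⟨x₀, x₁, hx, h0, h1⟩ := exists_zero_chain (M := M) (ne_zero_of_mem_unitVectors hv) hDv
    (add_smul_compl_mulVec_self hv hKv ε) hr
  exact ⟨⟨_, _, _, _, hM, hD, hK', hG, rfl⟩, not_pencilIsStable_of_zero_chain hx h0 h1⟩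

theorem mem_closure_regularHighIndex_iff :
    quadPoly M D K G ∈ closure (regularHighIndex n) ↔ HaveCommonKernel ![M, D] := by
  refine ⟨fun h => ?_, mem_closure_regularHighIndex_of_haveCommonKernel hM hD hK hG⟩
  have : HaveCommonKernel _ := closure_minimal
    (fun P hP => haveCommonKernel_of_regularHighIndex hP)
    (isClosed_setOf_haveCommonKernel_comp (j := 2)) h
  rwa [quadPoly_symm_part hD hG, haveCommonKernel_pair_two_smul] at this

theorem mem_closure_unstableSet_iff :
    quadPoly M D K G ∈ closure (unstableSet n) ↔
      HaveCommonKernel ![M, D] ∨ HaveCommonKernel ![D, K] := by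
  refine ⟨fun h => ?_, fun h => h.elim (fun h => ?_)
    (mem_closure_unstableSet_of_haveCommonKernel hM hD hK hG)⟩
  · have : HaveCommonKernel _ ∨ HaveCommonKernel _ := closure_minimal
      (fun P hP => haveCommonKernel_of_mem_unstableSet hP)
      ((isClosed_setOf_haveCommonKernel_comp (j := 2)).union
        (isClosed_setOf_haveCommonKernel_comp (j := 0))) h
    rwa [quadPoly_symm_part hD hG,
      haveCommonKernel_pair_two_smul, haveCommonKernel_pair_two_smul,
      haveCommonKernel_pair_comm (X := quadPoly M D K G 0)] at this
  · exact closure_mono regularHighIndex_subset_unstableSet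
      (mem_closure_regularHighIndex_of_haveCommonKernel hM hD hK hG h)

end Closure

/-! ### Structured distances of quadratic polynomials -/

section Distances

variable {n : ℕ}

theorem quadPoly_add (M D K G M' D' K' G' : Matrix (Fin n) (Fin n) ℝ) :
    quadPoly M D K G + quadPoly M' D' K' G' = quadPoly (M + M') (D + D') (K + K') (G + G') := by
  funext i
  fin_cases i
  · rfl
  · change -(G - D) + -(G' - D') = -(G + G' - (D + D'))
    abel
  · rfl

/-- Symmetric and skew-symmetric matrices are orthogonal, so the middle coefficient splits without a
cross term. -/
theorem frobSq_skew_sub_symm {G D : Matrix (Fin n) (Fin n) ℝ} (hD : Dᵀ = D) (hG : Gᵀ = -G) :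
    frobSq (-(G - D)) = frobSq G + frobSq D := by
  have h : ∑ a, ∑ b, G a b * D a b = -∑ a, ∑ b, G a b * D a b := by
    rw [← Finset.sum_neg_distrib]
    conv_lhs => rw [Finset.sum_comm]
    refine Finset.sum_congr rfl fun a _ => ?_
    rw [← Finset.sum_neg_distrib]
    refine Finset.sum_congr rfl fun b _ => ?_
    have h1 : G b a = -G a b := congrFun (congrFun hG a) b
    have h2 : D b a = D a b := congrFun (congrFun hD a) b
    rw [h1, h2, neg_mul]
  have h' : ∑ a, ∑ b, G a b * D a b = 0 := by linarith
  have : frobSq (-(G - D)) = frobSq G + frobSq D - 2 * ∑ a, ∑ b, G a b * D a b := by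
    simp only [frobSq, Finset.mul_sum, ← Finset.sum_add_distrib, ← Finset.sum_sub_distrib]
    refine Finset.sum_congr rfl fun a _ => Finset.sum_congr rfl fun b _ => ?_
    rw [Matrix.neg_apply, Matrix.sub_apply]
    ring
  rw [this, h']
  ring

theorem frobNorm_quadPoly {M D K G : Matrix (Fin n) (Fin n) ℝ} (hD : Dᵀ = D) (hG : Gᵀ = -G) :
    frobNorm (quadPoly M D K G) = √(frobSq G + frobSq M + frobSq D + frobSq K) := by
  rw [frobNorm_eq, Fin.sum_univ_three]
  change √(frobSq K + frobSq (-(G - D)) + frobSq M) = _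
  rw [frobSq_skew_sub_symm hD hG]
  ring_nf

theorem transpose_pert {u : Fin n → ℝ} {X : Matrix (Fin n) (Fin n) ℝ} (hX : X.PosSemidef) :
    (pert u X)ᵀ = pert u X := by
  have h : (X + pert u X)ᵀ = X + pert u X := (posSemidef_add_pert u hX).isHermitian
  rw [Matrix.transpose_add, show Xᵀ = X from hX.isHermitian] at h
  exact add_left_cancel h

theorem transpose_pert_skew {u : Fin n → ℝ} {X : Matrix (Fin n) (Fin n) ℝ} (hX : Xᵀ = -X) :
    (pert u X)ᵀ = -pert u X := by
  have h := transpose_add_pert u hX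
  rw [Matrix.transpose_add, hX, neg_add] at h
  exact add_left_cancel h

theorem pert_zero (u : Fin n → ℝ) : pert u (0 : Matrix (Fin n) (Fin n) ℝ) = 0 := by
  simp [pert]

theorem frobSq_zero : frobSq (0 : Matrix (Fin n) (Fin n) ℝ) = 0 := by
  simp [frobSq]

theorem continuous_frobNorm {ι : Type*} [Fintype ι] :
    Continuous (frobNorm : (ι → Matrix (Fin n) (Fin n) ℝ) → ℝ) := by
  unfold frobNorm
  refine Real.continuous_sqrt.comp (continuous_finsetSum _ fun i _ => continuous_finsetSum _
    fun a _ => continuous_finsetSum _ fun b _ => ?_)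
  exact (((continuous_apply i).matrix_elem a b)).pow 2

/-- A perturbation that only reaches the closure of `S` still determines the infimum over `S`,
because the norm is continuous. -/
theorem sInf_frobNorm_eq {ι : Type*} [Fintype ι] {P Δ₀ : ι → Matrix (Fin n) (Fin n) ℝ}
    {S : Set (ι → Matrix (Fin n) (Fin n) ℝ)} {d : ℝ}
    (h : ∀ Δ, P + Δ ∈ S → d ≤ frobNorm Δ) (h₀ : P + Δ₀ ∈ closure S) (hd : frobNorm Δ₀ = d) :
    sInf (frobNorm '' {Δ | P + Δ ∈ S}) = d := by
  have hcl : Δ₀ ∈ closure {Δ | P + Δ ∈ S} := by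
    have := (Homeomorph.addLeft P).preimage_closure S
    exact this.subset h₀
  have hne : {Δ | P + Δ ∈ S}.Nonempty := closure_nonempty_iff.mp ⟨_, hcl⟩
  have hbdd : BddBelow (frobNorm '' {Δ | P + Δ ∈ S}) :=
    ⟨d, by rintro _ ⟨Δ, hΔ, rfl⟩; exact h Δ hΔ⟩
  refine le_antisymm ?_ (le_csInf (hne.image _) (by rintro _ ⟨Δ, hΔ, rfl⟩; exact h Δ hΔ))
  rw [← hd]
  exact closure_minimal (t := {Δ | sInf (frobNorm '' {Δ | P + Δ ∈ S}) ≤ frobNorm Δ})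
    (fun Δ hΔ => csInf_le hbdd ⟨Δ, hΔ, rfl⟩) (isClosed_le continuous_const continuous_frobNorm) hcl

theorem exists_of_add_mem_dHClass {M D K G : Matrix (Fin n) (Fin n) ℝ} (hD : D.PosSemidef)
    (hG : Gᵀ = -G) {Δ : Fin 3 → Matrix (Fin n) (Fin n) ℝ}
    (h : quadPoly M D K G + Δ ∈ dHClass n) :
    ∃ M' D' K' G' : Matrix (Fin n) (Fin n) ℝ, M'.PosSemidef ∧ D'.PosSemidef ∧ K'.PosSemidef ∧
      G'ᵀ = -G' ∧ quadPoly M D K G + Δ = quadPoly M' D' K' G' ∧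
      frobNorm Δ = √(frobSq (G' - G) + frobSq (M' - M) + frobSq (D' - D) + frobSq (K' - K)) := by
  obtain ⟨M', D', K', G', hM', hD', hK', hG', h⟩ := h
  refine ⟨M', D', K', G', hM', hD', hK', hG', h, ?_⟩
  -- The differences need not be semidefinite; symmetry of `D' - D` and skewness of `G' - G` suffice
  -- for the norm formula.
  have hΔ : Δ = quadPoly (M' - M) (D' - D) (K' - K) (G' - G) := by
    refine add_left_cancel (a := quadPoly M D K G) ?_
    rw [h, quadPoly_add]
    simp only [add_sub_cancel]
  rw [hΔ, frobNorm_quadPoly]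
  · rw [Matrix.transpose_sub, show D'ᵀ = D' from hD'.isHermitian,
      show Dᵀ = D from hD.isHermitian]
  · rw [Matrix.transpose_sub, hG, hG']; abel

theorem mem_structTuples_three {M D K G : Matrix (Fin n) (Fin n) ℝ} (hM : M.PosSemidef)
    (hD : D.PosSemidef) (hK : K.PosSemidef) (hG : Gᵀ = -G) :
    (![G, M, D, K] : Fin (2 + 2) → Matrix (Fin n) (Fin n) ℝ) ∈ structTuples n 2 :=
  ⟨hG, fun i => by fin_cases i; exacts [hM, hD, hK]⟩

theorem mem_structTuples_two {X Y : Matrix (Fin n) (Fin n) ℝ} (hX : X.PosSemidef)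
    (hY : Y.PosSemidef) :
    (![0, X, Y] : Fin (1 + 2) → Matrix (Fin n) (Fin n) ℝ) ∈ structTuples n 1 :=
  ⟨by simp, fun i => by fin_cases i; exacts [hX, hY]⟩

theorem distCommonKernel_two_le {X Y X' Y' : Matrix (Fin n) (Fin n) ℝ} (hX' : X'.PosSemidef)
    (hY' : Y'.PosSemidef) (h : HaveCommonKernel ![X', Y']) :
    distCommonKernel (ℓ := 1) ![0, X, Y] ≤ √(frobSq (X' - X) + frobSq (Y' - Y)) := by
  have hadd : (![0, X, Y] + ![0, X' - X, Y' - Y] : Fin (1 + 2) → Matrix (Fin n) (Fin n) ℝ) =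
      ![0, X', Y'] := by simp
  have := distCommonKernel_le (ℓ := 1) (Y := ![0, X, Y]) (Δ := ![0, X' - X, Y' - Y])
    (by rw [hadd]; exact mem_structTuples_two hX' hY')
    (by rw [hadd]; exact haveCommonKernel_zero_pair.mpr h)
  refine this.trans (le_of_eq ?_)
  rw [frobNorm_eq, Fin.sum_univ_three]
  simp [frobSq_zero]

theorem distCommonKernel_three_le {M D K G M' D' K' G' : Matrix (Fin n) (Fin n) ℝ}
    (hM' : M'.PosSemidef) (hD' : D'.PosSemidef) (hK' : K'.PosSemidef) (hG' : G'ᵀ = -G')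
    (h : HaveCommonKernel ![M', D', K', G']) :
    distCommonKernel (ℓ := 2) ![G, M, D, K] ≤
      √(frobSq (G' - G) + frobSq (M' - M) + frobSq (D' - D) + frobSq (K' - K)) := by
  have hadd : (![G, M, D, K] + ![G' - G, M' - M, D' - D, K' - K] :
      Fin (2 + 2) → Matrix (Fin n) (Fin n) ℝ) = ![G', M', D', K'] := by simp
  have := distCommonKernel_le (ℓ := 2) (Y := ![G, M, D, K])
    (Δ := ![G' - G, M' - M, D' - D, K' - K])
    (by rw [hadd]; exact mem_structTuples_three hM' hD' hK' hG')
    (by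
      rw [hadd]
      obtain ⟨v, hv, hv0⟩ := h
      exact ⟨v, hv, fun i => by fin_cases i; exacts [hv0 3, hv0 0, hv0 1, hv0 2]⟩)
  refine this.trans (le_of_eq ?_)
  rw [frobNorm_eq, Fin.sum_univ_four]
  simp

theorem exists_minimizer_two (hn : 1 ≤ n) {X Y : Matrix (Fin n) (Fin n) ℝ} (hX : X.PosSemidef)
    (hY : Y.PosSemidef) : ∃ u ∈ unitVectors n,
      √(frobSq (pert u X) + frobSq (pert u Y)) = distCommonKernel (ℓ := 1) ![0, X, Y] ∧
      HaveCommonKernel ![X + pert u X, Y + pert u Y] := by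
  obtain ⟨u, hu, h1, -⟩ := exists_minimizer hn (mem_structTuples_two hX hY)
  refine ⟨u, hu, ?_, u, ne_zero_of_mem_unitVectors hu, fun i => by
    fin_cases i <;> exact add_pert_mulVec_self hu _⟩
  rw [← h1, ← frobNorm_pert (mem_structTuples_two hX hY) hu, frobNorm_eq, Fin.sum_univ_three]
  simp [pert_zero, frobSq_zero]

theorem dotProduct_sq_mulVec {X : Matrix (Fin n) (Fin n) ℝ} (hX : X.PosSemidef)
    (u : Fin n → ℝ) : u ⬝ᵥ (X ^ 2 *ᵥ u) = sqNorm (X *ᵥ u) := by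
  rw [sq, ← Matrix.mulVec_mulVec, Matrix.dotProduct_mulVec, ← Matrix.mulVec_transpose,
    show Xᵀ = X from hX.isHermitian, sqNorm]

theorem dotProduct_sq_mulVec_skew {X : Matrix (Fin n) (Fin n) ℝ} (hX : Xᵀ = -X)
    (u : Fin n → ℝ) : u ⬝ᵥ (X ^ 2 *ᵥ u) = -sqNorm (X *ᵥ u) := by
  rw [sq, ← Matrix.mulVec_mulVec, Matrix.dotProduct_mulVec, ← Matrix.mulVec_transpose, hX,
    Matrix.neg_mulVec, neg_dotProduct, sqNorm]

theorem isHermitian_sq {X : Matrix (Fin n) (Fin n) ℝ} (hX : X.PosSemidef) :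
    (X ^ 2).IsHermitian := hX.isHermitian.pow 2

theorem lambdaMin_bounds_two (hn : 1 ≤ n) {X Y : Matrix (Fin n) (Fin n) ℝ} (hX : X.PosSemidef)
    (hY : Y.PosSemidef) :
    √(lambdaMin (X ^ 2 + Y ^ 2)) ≤ distCommonKernel (ℓ := 1) ![0, X, Y] ∧
      distCommonKernel (ℓ := 1) ![0, X, Y] ≤ √(2 * lambdaMin (X ^ 2 + Y ^ 2)) := by
  refine lambdaMin_bounds hn (mem_structTuples_two hX hY)
    ((isHermitian_sq hX).add (isHermitian_sq hY)) fun u => ?_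
  rw [Fin.sum_univ_three, Matrix.add_mulVec, dotProduct_add, dotProduct_sq_mulVec hX,
    dotProduct_sq_mulVec hY]
  simp [sqNorm]

theorem lambdaMin_bounds_three (hn : 1 ≤ n) {M D K G : Matrix (Fin n) (Fin n) ℝ}
    (hM : M.PosSemidef) (hD : D.PosSemidef) (hK : K.PosSemidef) (hG : Gᵀ = -G) :
    √(lambdaMin (M ^ 2 + D ^ 2 + K ^ 2 - G ^ 2)) ≤ distCommonKernel (ℓ := 2) ![G, M, D, K] ∧
      distCommonKernel (ℓ := 2) ![G, M, D, K] ≤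
        √(2 * lambdaMin (M ^ 2 + D ^ 2 + K ^ 2 - G ^ 2)) := by
  have hG2 : (G ^ 2).IsHermitian := by
    change (G ^ 2)ᵀ = G ^ 2
    rw [Matrix.transpose_pow, hG, neg_sq]
  refine lambdaMin_bounds hn (mem_structTuples_three hM hD hK hG)
    ((((isHermitian_sq hM).add (isHermitian_sq hD)).add (isHermitian_sq hK)).sub hG2) fun u => ?_
  rw [Fin.sum_univ_four, Matrix.sub_mulVec, Matrix.add_mulVec, Matrix.add_mulVec, dotProduct_sub,
    dotProduct_add, dotProduct_add, dotProduct_sq_mulVec hM, dotProduct_sq_mulVec hD,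
    dotProduct_sq_mulVec hK, dotProduct_sq_mulVec_skew hG]
  simp only [Matrix.cons_val]
  ring

/-! ### Attainment and values of the three distances. -/

section Class

variable {M D K G : Matrix (Fin n) (Fin n) ℝ}

theorem exists_minimizer_singular (hn : 1 ≤ n) (hM : M.PosSemidef) (hD : D.PosSemidef)
    (hK : K.PosSemidef) (hG : Gᵀ = -G) : ∃ u ∈ unitVectors n,
      quadPoly M D K G + quadPoly (pert u M) (pert u D) (pert u K) (pert u G) ∈ dHClass n ∧
      IsSingular (quadPoly M D K G + quadPoly (pert u M) (pert u D) (pert u K) (pert u G)) ∧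
      frobNorm (quadPoly (pert u M) (pert u D) (pert u K) (pert u G)) =
        distCommonKernel (ℓ := 2) ![G, M, D, K] := by
  obtain ⟨u, hu, h1, -⟩ := exists_minimizer hn (mem_structTuples_three hM hD hK hG)
  refine ⟨u, hu, ?_, ?_, ?_⟩
  · rw [quadPoly_add]
    exact ⟨_, _, _, _, posSemidef_add_pert u hM, posSemidef_add_pert u hD,
      posSemidef_add_pert u hK, transpose_add_pert u hG, rfl⟩
  · rw [quadPoly_add, isSingular_iff (posSemidef_add_pert u hM) (posSemidef_add_pert u hD)
      (posSemidef_add_pert u hK) (transpose_add_pert u hG)]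
    exact ⟨u, ne_zero_of_mem_unitVectors hu, fun i => by
      fin_cases i <;> exact add_pert_mulVec_self hu _⟩
  · rw [frobNorm_quadPoly (transpose_pert hD) (transpose_pert_skew hG), ← h1,
      ← frobNorm_pert (mem_structTuples_three hM hD hK hG) hu, frobNorm_eq, Fin.sum_univ_four]
    simp

theorem distSing_eq (hn : 1 ≤ n) (hM : M.PosSemidef) (hD : D.PosSemidef)
    (hK : K.PosSemidef) (hG : Gᵀ = -G) :
    distSing (quadPoly M D K G) = distCommonKernel (ℓ := 2) ![G, M, D, K] := by
  obtain ⟨u, hu, h1, h2, h3⟩ := exists_minimizer_singular hn hM hD hK hG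
  refine sInf_frobNorm_eq (S := {P | P ∈ dHClass n ∧ IsSingular P}) (fun Δ hΔ => ?_)
    (subset_closure ⟨h1, h2⟩) h3
  obtain ⟨M', D', K', G', hM', hD', hK', hG', heq, hnorm⟩ := exists_of_add_mem_dHClass hD hG hΔ.1
  have hs : IsSingular (quadPoly M D K G + Δ) := hΔ.2
  rw [heq, isSingular_iff hM' hD' hK' hG'] at hs
  rw [hnorm]
  exact distCommonKernel_three_le hM' hD' hK' hG' hs

theorem exists_minimizer_lead (hn : 1 ≤ n) (hM : M.PosSemidef) (hD : D.PosSemidef)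
    (hK : K.PosSemidef) (hG : Gᵀ = -G) : ∃ u ∈ unitVectors n,
      quadPoly M D K G + quadPoly (pert u M) (pert u D) 0 0 ∈ closure (regularHighIndex n) ∧
      frobNorm (quadPoly (pert u M) (pert u D) 0 0) = distCommonKernel (ℓ := 1) ![0, M, D] := by
  obtain ⟨u, hu, h1, h2⟩ := exists_minimizer_two hn hM hD
  refine ⟨u, hu, ?_, ?_⟩
  · rw [quadPoly_add, add_zero, add_zero]
    exact mem_closure_regularHighIndex_of_haveCommonKernel (posSemidef_add_pert u hM)
      (posSemidef_add_pert u hD) hK hG h2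
  · rw [frobNorm_quadPoly (transpose_pert hD) (by simp), ← h1, frobSq_zero, zero_add, add_zero]

theorem exists_minimizer_const (hn : 1 ≤ n) (hM : M.PosSemidef) (hD : D.PosSemidef)
    (hK : K.PosSemidef) (hG : Gᵀ = -G) : ∃ u ∈ unitVectors n,
      quadPoly M D K G + quadPoly 0 (pert u D) (pert u K) 0 ∈ closure (unstableSet n) ∧
      frobNorm (quadPoly 0 (pert u D) (pert u K) 0) = distCommonKernel (ℓ := 1) ![0, D, K] := by
  obtain ⟨u, hu, h1, h2⟩ := exists_minimizer_two hn hD hK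
  refine ⟨u, hu, ?_, ?_⟩
  · rw [quadPoly_add, add_zero, add_zero]
    exact mem_closure_unstableSet_of_haveCommonKernel hM (posSemidef_add_pert u hD)
      (posSemidef_add_pert u hK) hG h2
  · rw [frobNorm_quadPoly (transpose_pert hD) (by simp), ← h1, frobSq_zero, zero_add, zero_add]

theorem distCommonKernel_lead_le_frobNorm {M' D' K' G' : Matrix (Fin n) (Fin n) ℝ}
    (hM' : M'.PosSemidef) (hD' : D'.PosSemidef) (h : HaveCommonKernel ![M', D']) :
    distCommonKernel (ℓ := 1) ![0, M, D] ≤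
      √(frobSq (G' - G) + frobSq (M' - M) + frobSq (D' - D) + frobSq (K' - K)) :=
  (distCommonKernel_two_le hM' hD' h).trans (Real.sqrt_le_sqrt (by
    linarith [frobSq_nonneg (G' - G), frobSq_nonneg (K' - K)]))

theorem distCommonKernel_const_le_frobNorm {M' D' K' G' : Matrix (Fin n) (Fin n) ℝ}
    (hD' : D'.PosSemidef) (hK' : K'.PosSemidef) (h : HaveCommonKernel ![D', K']) :
    distCommonKernel (ℓ := 1) ![0, D, K] ≤
      √(frobSq (G' - G) + frobSq (M' - M) + frobSq (D' - D) + frobSq (K' - K)) :=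
  (distCommonKernel_two_le hD' hK' h).trans (Real.sqrt_le_sqrt (by
    linarith [frobSq_nonneg (G' - G), frobSq_nonneg (M' - M)]))

theorem distHighIndex_eq (hn : 1 ≤ n) (hM : M.PosSemidef) (hD : D.PosSemidef)
    (hK : K.PosSemidef) (hG : Gᵀ = -G) :
    distHighIndex (quadPoly M D K G) = distCommonKernel (ℓ := 1) ![0, M, D] := by
  obtain ⟨u, hu, h1, h2⟩ := exists_minimizer_lead hn hM hD hK hG
  have hsub : regularHighIndex n ⊆ {P | P ∈ dHClass n ∧ ∃ ν, HasIndex P ν ∧ 2 ≤ ν} :=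
    fun P hP => ⟨hP.1, hP.2.2⟩
  -- The infimum also ranges over singular polynomials of index at least two, but the kernel
  -- condition behind the lower bound does not use regularity.
  refine sInf_frobNorm_eq (fun Δ hΔ => ?_) (closure_mono hsub h1) h2
  obtain ⟨M', D', K', G', hM', hD', hK', hG', heq, hnorm⟩ := exists_of_add_mem_dHClass hD hG hΔ.1
  obtain ⟨ν, hν, h2⟩ := hΔ.2
  rw [heq] at hν
  rw [hnorm]
  exact distCommonKernel_lead_le_frobNorm hM' hD'
    (haveCommonKernel_of_hasIndex hM' hD' hG' hν h2)

theorem exists_minimizer_unstable (hn : 1 ≤ n) (hM : M.PosSemidef) (hD : D.PosSemidef)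
    (hK : K.PosSemidef) (hG : Gᵀ = -G) : ∃ u ∈ unitVectors n,
      (quadPoly M D K G + quadPoly (pert u M) (pert u D) 0 0 ∈ closure (unstableSet n) ∧
        frobNorm (quadPoly (pert u M) (pert u D) 0 0) =
          min (distCommonKernel (ℓ := 1) ![0, M, D]) (distCommonKernel (ℓ := 1) ![0, D, K])) ∨
      (quadPoly M D K G + quadPoly 0 (pert u D) (pert u K) 0 ∈ closure (unstableSet n) ∧
        frobNorm (quadPoly 0 (pert u D) (pert u K) 0) =
          min (distCommonKernel (ℓ := 1) ![0, M, D]) (distCommonKernel (ℓ := 1) ![0, D, K])) := by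
  rcases le_total (distCommonKernel (ℓ := 1) ![0, M, D]) (distCommonKernel (ℓ := 1) ![0, D, K])
    with hle | hle
  · obtain ⟨u, hu, h1, h2⟩ := exists_minimizer_lead hn hM hD hK hG
    exact ⟨u, hu, Or.inl ⟨closure_mono regularHighIndex_subset_unstableSet h1,
      by rw [h2, min_eq_left hle]⟩⟩
  · obtain ⟨u, hu, h1, h2⟩ := exists_minimizer_const hn hM hD hK hG
    exact ⟨u, hu, Or.inr ⟨h1, by rw [h2, min_eq_right hle]⟩⟩

theorem distInstability_eq (hn : 1 ≤ n) (hM : M.PosSemidef) (hD : D.PosSemidef)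
    (hK : K.PosSemidef) (hG : Gᵀ = -G) :
    distInstability (quadPoly M D K G) =
      min (distCommonKernel (ℓ := 1) ![0, M, D]) (distCommonKernel (ℓ := 1) ![0, D, K]) := by
  have hlow : ∀ Δ, quadPoly M D K G + Δ ∈ unstableSet n →
      min (distCommonKernel (ℓ := 1) ![0, M, D]) (distCommonKernel (ℓ := 1) ![0, D, K]) ≤
        frobNorm Δ := by
    intro Δ hΔ
    obtain ⟨M', D', K', G', hM', hD', hK', hG', heq, hnorm⟩ := exists_of_add_mem_dHClass hD hG hΔ.1
    have hs := hΔ.2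
    rw [heq] at hs
    rw [hnorm]
    rcases haveCommonKernel_of_unstable hM' hD' hK' hG' hs with h | h
    · exact (min_le_left _ _).trans (distCommonKernel_lead_le_frobNorm hM' hD' h)
    · exact (min_le_right _ _).trans (distCommonKernel_const_le_frobNorm hD' hK' h)
  obtain ⟨u, hu, h | h⟩ := exists_minimizer_unstable hn hM hD hK hG
  · exact sInf_frobNorm_eq hlow h.1 h.2
  · exact sInf_frobNorm_eq hlow h.1 h.2

end Class

end Distances

end DHQuad

end

/-! ### Assembly of the three statements. -/

theorem theorem5p3 (n : ℕ) (hn : 1 ≤ n) (M D K G : Matrix (Fin n) (Fin n) ℝ)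
    (hM : M.PosSemidef) (hD : D.PosSemidef) (hK : K.PosSemidef) (hG : Gᵀ = -G) :
    -- distance to singularity
    ((DHQuad.IsSingular (DHQuad.quadPoly M D K G) ↔ DHQuad.HaveCommonKernel ![M, D, K, G]) ∧
      (∃ u ∈ DHQuad.unitVectors n,
        DHQuad.quadPoly M D K G +
            DHQuad.quadPoly (DHQuad.pert u M) (DHQuad.pert u D) (DHQuad.pert u K) (DHQuad.pert u G)
          ∈ DHQuad.dHClass n ∧
        DHQuad.IsSingular (DHQuad.quadPoly M D K G +
          DHQuad.quadPoly (DHQuad.pert u M) (DHQuad.pert u D) (DHQuad.pert u K)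
            (DHQuad.pert u G)) ∧
        DHQuad.frobNorm (DHQuad.quadPoly (DHQuad.pert u M) (DHQuad.pert u D) (DHQuad.pert u K)
          (DHQuad.pert u G)) = DHQuad.distSing (DHQuad.quadPoly M D K G)) ∧
      DHQuad.distSing (DHQuad.quadPoly M D K G) = DHQuad.distCommonKernel ![G, M, D, K] ∧
      IsLeast (DHQuad.kernelCost ![G, M, D, K] '' DHQuad.unitVectors n)
        (DHQuad.distCommonKernel ![G, M, D, K]) ∧
      √(DHQuad.lambdaMin (M ^ 2 + D ^ 2 + K ^ 2 - G ^ 2)) ≤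
        DHQuad.distSing (DHQuad.quadPoly M D K G) ∧
      DHQuad.distSing (DHQuad.quadPoly M D K G) ≤
        √(2 * DHQuad.lambdaMin (M ^ 2 + D ^ 2 + K ^ 2 - G ^ 2))) ∧
    -- distance to higher index
    ((DHQuad.quadPoly M D K G ∈ closure (DHQuad.regularHighIndex n) ↔
        DHQuad.HaveCommonKernel ![M, D]) ∧
      (∀ P ∈ DHQuad.regularHighIndex n, ∀ ν, DHQuad.HasIndex P ν → ν = 2) ∧
      (∃ u ∈ DHQuad.unitVectors n,
        DHQuad.quadPoly M D K G + DHQuad.quadPoly (DHQuad.pert u M) (DHQuad.pert u D) 0 0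
          ∈ closure (DHQuad.regularHighIndex n) ∧
        DHQuad.frobNorm (DHQuad.quadPoly (DHQuad.pert u M) (DHQuad.pert u D) 0 0) =
          DHQuad.distHighIndex (DHQuad.quadPoly M D K G)) ∧
      DHQuad.distHighIndex (DHQuad.quadPoly M D K G) = DHQuad.distCommonKernel ![0, M, D] ∧
      IsLeast (DHQuad.kernelCost ![0, M, D] '' DHQuad.unitVectors n)
        (DHQuad.distCommonKernel ![0, M, D]) ∧
      √(DHQuad.lambdaMin (M ^ 2 + D ^ 2)) ≤ DHQuad.distHighIndex (DHQuad.quadPoly M D K G) ∧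
      DHQuad.distHighIndex (DHQuad.quadPoly M D K G) ≤ √(2 * DHQuad.lambdaMin (M ^ 2 + D ^ 2))) ∧
    -- distance to instability
    ((DHQuad.quadPoly M D K G ∈ closure (DHQuad.unstableSet n) ↔
        DHQuad.HaveCommonKernel ![M, D] ∨ DHQuad.HaveCommonKernel ![D, K]) ∧
      (∃ u ∈ DHQuad.unitVectors n,
        (DHQuad.quadPoly M D K G + DHQuad.quadPoly (DHQuad.pert u M) (DHQuad.pert u D) 0 0
            ∈ closure (DHQuad.unstableSet n) ∧
          DHQuad.frobNorm (DHQuad.quadPoly (DHQuad.pert u M) (DHQuad.pert u D) 0 0) =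
            DHQuad.distInstability (DHQuad.quadPoly M D K G)) ∨
        (DHQuad.quadPoly M D K G + DHQuad.quadPoly 0 (DHQuad.pert u D) (DHQuad.pert u K) 0
            ∈ closure (DHQuad.unstableSet n) ∧
          DHQuad.frobNorm (DHQuad.quadPoly 0 (DHQuad.pert u D) (DHQuad.pert u K) 0) =
            DHQuad.distInstability (DHQuad.quadPoly M D K G))) ∧
      DHQuad.distInstability (DHQuad.quadPoly M D K G) =
        min (DHQuad.distCommonKernel ![0, M, D]) (DHQuad.distCommonKernel ![0, D, K]) ∧
      IsLeast (DHQuad.kernelCost ![0, D, K] '' DHQuad.unitVectors n)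
        (DHQuad.distCommonKernel ![0, D, K]) ∧
      √(min (DHQuad.lambdaMin (M ^ 2 + D ^ 2)) (DHQuad.lambdaMin (D ^ 2 + K ^ 2))) ≤
        DHQuad.distInstability (DHQuad.quadPoly M D K G) ∧
      DHQuad.distInstability (DHQuad.quadPoly M D K G) ≤
        √(2 * min (DHQuad.lambdaMin (M ^ 2 + D ^ 2)) (DHQuad.lambdaMin (D ^ 2 + K ^ 2)))) := by
  have h3 := DHQuad.lambdaMin_bounds_three hn hM hD hK hG
  have hMD := DHQuad.lambdaMin_bounds_two hn hM hD
  have hDK := DHQuad.lambdaMin_bounds_two hn hD hK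
  refine ⟨⟨DHQuad.isSingular_iff hM hD hK hG, ?_, DHQuad.distSing_eq hn hM hD hK hG,
    DHQuad.isLeast_kernelCost hn (DHQuad.mem_structTuples_three hM hD hK hG), ?_, ?_⟩,
    ⟨DHQuad.mem_closure_regularHighIndex_iff hM hD hK hG, ?_, ?_,
      DHQuad.distHighIndex_eq hn hM hD hK hG,
      DHQuad.isLeast_kernelCost hn (DHQuad.mem_structTuples_two hM hD), ?_, ?_⟩,
    ⟨DHQuad.mem_closure_unstableSet_iff hM hD hK hG, ?_, DHQuad.distInstability_eq hn hM hD hK hG,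
      DHQuad.isLeast_kernelCost hn (DHQuad.mem_structTuples_two hD hK), ?_, ?_⟩⟩
  · rw [DHQuad.distSing_eq hn hM hD hK hG]
    exact DHQuad.exists_minimizer_singular hn hM hD hK hG
  · exact h3.1.trans_eq (DHQuad.distSing_eq hn hM hD hK hG).symm
  · exact (DHQuad.distSing_eq hn hM hD hK hG).trans_le h3.2
  · rintro _ ⟨⟨M', D', K', G', hM', hD', hK', hG', rfl⟩, hs, hex⟩ ν hν
    exact DHQuad.index_eq_two hM' hD' hK' hG' hν hs hex
  · rw [DHQuad.distHighIndex_eq hn hM hD hK hG]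
    exact DHQuad.exists_minimizer_lead hn hM hD hK hG
  · exact hMD.1.trans_eq (DHQuad.distHighIndex_eq hn hM hD hK hG).symm
  · exact (DHQuad.distHighIndex_eq hn hM hD hK hG).trans_le hMD.2
  · rw [DHQuad.distInstability_eq hn hM hD hK hG]
    exact DHQuad.exists_minimizer_unstable hn hM hD hK hG
  · refine le_of_le_of_eq (le_min ?_ ?_) (DHQuad.distInstability_eq hn hM hD hK hG).symm
    · exact (Real.sqrt_le_sqrt (min_le_left _ _)).trans hMD.1
    · exact (Real.sqrt_le_sqrt (min_le_right _ _)).trans hDK.1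
  · refine (DHQuad.distInstability_eq hn hM hD hK hG).trans_le ?_
    rcases min_choice (DHQuad.lambdaMin (M ^ 2 + D ^ 2)) (DHQuad.lambdaMin (D ^ 2 + K ^ 2))
      with h | h
    · rw [h]
      exact (min_le_left _ _).trans hMD.2
    · rw [h]
      exact (min_le_right _ _).trans hDK.2
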